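/- Let $n,k\in\mathbb N$ with $1\le k\le n/2$. The players are $1,\dots,n$, a team is a set of exactly $k$ players, and there is an unknown strict total order $\succ$ on the teams which is additive: there are real values $v(1),\dots,v(n)$ such that, for all teams $A,B$, $A\succ B$ if and only if $\sum_{a\in A}v(a)>\sum_{b\in B}v(b)$. A learner, who knows $n$ and $k$ but neither $\succ$ nor the values, may adaptively perform duels: in a duel it selects two disjoint teams $A$ and $B$ and is told, without noise (deterministic feedback), whether $A\succ B$ or $B\succ A$. A team $A$ is a Condorcet winning team if $A\succ B$ for every team $B$ with $A\cap B=\emptyset$. **Theorem.** For deterministic feedback and additive total orders, there exists an algorithm that finds a Condorcet winning team within $\mathcal O(kn\log k+k^5)$ duels, where $\log k$ is read as $\log 2$ when $k=1$. That is, there is an absolute constant $C$ such that for all $n,k$ with $1\le k\le n/2$ there is a deterministic adaptive algorithm which, for every additive strict total order $\succ$ on the teams, stops after at most $C\,(kn\log(\max\{k,2\})+k^5)$ duels and outputs a Condorcet winning team. -/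

import Mathlib

namespace DuelingTeams

/-- A team: a set of exactly `k` of the `n` players. -/
abbrev Team (n k : ℕ) : Type := {A : Finset (Fin n) // A.card = k}

/-- The order `r` on teams (`r A B` means `A ≻ B`) is additive: for some values of the players,
`A ≻ B` holds exactly when the total value of `A` exceeds that of `B`. -/
def IsAdditive {n k : ℕ} (r : Team n k → Team n k → Prop) : Prop :=
  ∃ v : Fin n → ℝ, ∀ A B : Team n k, r A B ↔ ∑ b ∈ B.1, v b < ∑ a ∈ A.1, v a

/-- `A` is a Condorcet winning team for `r`: it is better than every team disjoint from it. -/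
def IsCondorcetWinning {n k : ℕ} (r : Team n k → Team n k → Prop) (A : Team n k) : Prop :=
  ∀ B : Team n k, Disjoint A.1 B.1 → r A B

/-- A deterministic adaptive algorithm of the learner. It either stops and outputs a team, or
performs a duel between two disjoint teams `A` and `B`, continuing with `ifWin` when the
feedback is that `A` beats `B` and with `ifLoss` when the feedback is that `B` beats `A`. -/
inductive Algo (n k : ℕ) : Type
  | output (W : Team n k) : Algo n k
  | duel (A B : Team n k) (hAB : Disjoint A.1 B.1) (ifWin ifLoss : Algo n k) : Algo n k

namespace Algo

open Classical in
/-- The team that the algorithm outputs when duels are answered (without noise) by `r`. -/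
noncomputable def result {n k : ℕ} (r : Team n k → Team n k → Prop) : Algo n k → Team n k
  | output W => W
  | duel A B _ ifWin ifLoss => if r A B then ifWin.result r else ifLoss.result r

open Classical in
/-- The number of duels that the algorithm performs when duels are answered by `r`. -/
noncomputable def numDuels {n k : ℕ} (r : Team n k → Team n k → Prop) : Algo n k → ℕ
  | output _ => 0
  | duel A B _ ifWin ifLoss => (if r A B then ifWin.numDuels r else ifLoss.numDuels r) + 1

end Algo

end DuelingTeams

/-! The learner keeps the set `F` of value vectors consistent with all answers, so an algorithm is a
way of shrinking `F`. Take disjoint pairs `(α i, β i)` and let them change sides one after another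
(`stage`). The first and last duels have opposite outcomes, so the outcome changes at some pair, and
that pair is thereby compared. Binary search finds such a pair in about `log k` duels.

Elimination: a player with `2 * k` players known to be better is irrelevant. While at least `4 * k`
players are alive, there are `k` disjoint pairs of incomparable live players
(`exists_unknown_pairs`), and a binary search yields a new comparison. A potential bounded by `2 * k
* n` counts these (`of_many_alive`), which costs `O(kn log k)` duels.

Endgame: at most `4 * k` players remain, and `O(m ^ 5)` duels suffice for `m` players
(`of_generic`). Call the components of the graph of incomparable pairs tiers; what is known orders
them linearly (`exists_rank`). A test asks whether exchanging two players of one tier leaves a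
duel's outcome unchanged. If all of `O(m ^ 4)` tests pass, the first `k` players in tier order form
a Condorcet winning team (`exists_tests`). If one fails, writing the transposition as a product of
transpositions along edges gives a comparison on some edge; repeating this disconnects the two
players and splits a tier (`of_flip`). There are at most `m` tiers, so few rounds occur.

The certificate: let `δ` be the largest value difference within a tier. A rival team gains at most
`c * δ` over the players in positions `k` to `2 * k - 1` (`sum_le`). The winning team recovers this
loss because each of its first `c` players exceeds the one `2 * k` positions later by at least `δ`
(`exists_gap_tests`). -/

namespace DuelingTeams

variable {n k m : ℕ}

/-! ### Duels, values and permutations of players -/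

/-- The total value of a team. -/
def value (v : Fin n → ℝ) (A : Team n k) : ℝ := ∑ a ∈ A.1, v a

/-- The order on teams given by the values of the players. -/
def ofValues (v : Fin n → ℝ) : Team n k → Team n k → Prop := fun A B => value v B < value v A

/-- Distinct teams of size `k` have distinct values. -/
def Generic (k : ℕ) (v : Fin n → ℝ) : Prop := ∀ A B : Team n k, A ≠ B → value v A ≠ value v B

/-- A pair of disjoint teams. -/
structure Duel (n k : ℕ) where
  fst : Team n k
  snd : Team n k
  disj : Disjoint fst.1 snd.1

namespace Duel

/-- The first team wins the duel for the player values `v`. -/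
def Win (d : Duel n k) (v : Fin n → ℝ) : Prop := value v d.snd < value v d.fst

/-- The value by which the first team exceeds the second one. -/
def diff (d : Duel n k) (v : Fin n → ℝ) : ℝ := value v d.fst - value v d.snd

lemma win_iff (d : Duel n k) (v : Fin n → ℝ) : d.Win v ↔ 0 < d.diff v := by
  simp [Win, diff]

/-- The duel in which every player is replaced by its image under a permutation. -/
def permute (π : Equiv.Perm (Fin n)) (d : Duel n k) : Duel n k where
  fst := ⟨d.fst.1.map π.toEmbedding, by simp [d.fst.2]⟩
  snd := ⟨d.snd.1.map π.toEmbedding, by simp [d.snd.2]⟩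
  disj := (Finset.disjoint_map _).2 d.disj

lemma diff_permute (π : Equiv.Perm (Fin n)) (d : Duel n k) (v : Fin n → ℝ) :
    (d.permute π).diff v = d.diff (v ∘ π) := by
  simp [permute, diff, value]

lemma win_permute (π : Equiv.Perm (Fin n)) (d : Duel n k) (v : Fin n → ℝ) :
    (d.permute π).Win v ↔ d.Win (v ∘ π) := by
  simp [win_iff, diff_permute]

lemma diff_ne_zero (hk : 1 ≤ k) (d : Duel n k) {v : Fin n → ℝ} (hv : Generic k v) :
    d.diff v ≠ 0 := by
  have hne : d.fst ≠ d.snd := by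
    intro h
    have h1 := d.disj
    rw [h, disjoint_self] at h1
    have h2 := d.snd.2
    rw [h1] at h2
    simp at h2
    omega
  exact sub_ne_zero.2 (hv _ _ hne)

/-- The contribution of a player to the difference of a duel: `1`, `-1` or `0`. -/
noncomputable def sign (d : Duel n k) (x : Fin n) : ℝ :=
  (if x ∈ d.fst.1 then 1 else 0) - (if x ∈ d.snd.1 then 1 else 0)

lemma diff_eq_sum (d : Duel n k) (v : Fin n → ℝ) : d.diff v = ∑ x, d.sign x * v x := by
  simp [sign, diff, value, sub_mul, Finset.sum_sub_distrib, ite_mul]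

lemma diff_comp_swap (d : Duel n k) (v : Fin n → ℝ) (x y : Fin n) :
    d.diff (v ∘ Equiv.swap x y) - d.diff v = (d.sign x - d.sign y) * (v y - v x) := by
  rcases eq_or_ne x y with rfl | hxy
  · simp
  rw [diff_eq_sum, diff_eq_sum, ← Finset.sum_sub_distrib]
  rw [← Finset.sum_subset (Finset.subset_univ {x, y})]
  · rw [Finset.sum_pair hxy]
    simp
    ring
  · intro z _ hz
    simp only [Finset.mem_insert, Finset.mem_singleton, not_or] at hz
    simp [Equiv.swap_apply_of_ne_of_ne hz.1 hz.2]

end Duel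

/-! ### Search procedures on sets of consistent value vectors -/

/-- The learner, knowing that the vector of values belongs to `F`, can find a Condorcet winning
team within `N` duels. -/
def Solvable (k : ℕ) (F : Set (Fin n → ℝ)) (N : ℕ) : Prop :=
  ∃ alg : Algo n k, ∀ v ∈ F, IsCondorcetWinning (ofValues v) (alg.result (ofValues v)) ∧
    alg.numDuels (ofValues v) ≤ N

namespace Solvable

lemma mono {F F' : Set (Fin n → ℝ)} {N N' : ℕ} (h : Solvable k F N) (hF : F' ⊆ F)
    (hN : N ≤ N') : Solvable k F' N' := by
  obtain ⟨alg, h⟩ := h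
  exact ⟨alg, fun v hv => ⟨(h v (hF hv)).1, (h v (hF hv)).2.trans hN⟩⟩

lemma of_winning {F : Set (Fin n → ℝ)} (W : Team n k)
    (h : ∀ v ∈ F, IsCondorcetWinning (ofValues v) W) : Solvable k F 0 :=
  ⟨.output W, fun v hv => ⟨h v hv, le_rfl⟩⟩

lemma of_empty [Nonempty (Team n k)] (N : ℕ) : Solvable k (∅ : Set (Fin n → ℝ)) N :=
  (of_winning (Classical.arbitrary _) (by simp)).mono le_rfl (Nat.zero_le _)

lemma duel {F : Set (Fin n → ℝ)} {N : ℕ} (d : Duel n k)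
    (h1 : Solvable k {v ∈ F | d.Win v} N) (h2 : Solvable k {v ∈ F | ¬ d.Win v} N) :
    Solvable k F (N + 1) := by
  obtain ⟨a1, h1⟩ := h1
  obtain ⟨a2, h2⟩ := h2
  refine ⟨.duel d.fst d.snd d.disj a1 a2, fun v hv => ?_⟩
  by_cases hw : d.Win v
  · have hr : ofValues v d.fst d.snd := hw
    simpa [Algo.result, Algo.numDuels, hr] using h1 v ⟨hv, hw⟩
  · have hr : ¬ ofValues v d.fst d.snd := hw
    simpa [Algo.result, Algo.numDuels, hr] using h2 v ⟨hv, hw⟩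

/-- Performing a list of duels non-adaptively. -/
lemma batch [Nonempty (Team n k)] {N : ℕ} (L : List (Duel n k)) : ∀ {F : Set (Fin n → ℝ)},
    (∀ v₀ ∈ F, Solvable k {v ∈ F | ∀ d ∈ L, d.Win v ↔ d.Win v₀} N) →
    Solvable k F (N + L.length) := by
  induction L with
  | nil =>
    intro F h
    rcases F.eq_empty_or_nonempty with rfl | ⟨v, hv⟩
    · exact of_empty _
    · simpa using h v hv
  | cons d L ih =>
    intro F h
    rw [List.length_cons, ← Nat.add_assoc]
    refine duel d (ih fun v₀ h₀ => (h v₀ h₀.1).mono ?_ le_rfl)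
      (ih fun v₀ h₀ => (h v₀ h₀.1).mono ?_ le_rfl)
    · rintro v ⟨⟨hv, hw⟩, hL⟩
      refine ⟨hv, fun e he => ?_⟩
      rcases List.mem_cons.1 he with rfl | he
      · exact iff_of_true hw h₀.2
      · exact hL e he
    · rintro v ⟨⟨hv, hw⟩, hL⟩
      refine ⟨hv, fun e he => ?_⟩
      rcases List.mem_cons.1 he with rfl | he
      · exact iff_of_false hw h₀.2
      · exact hL e he

/-- Binary search for a change of outcome in a sequence of duels whose ends differ. -/
lemma binary_search {N : ℕ} (d : ℕ → Duel n k) (c : Prop) : ∀ (q i j : ℕ)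
    {F : Set (Fin n → ℝ)}, i < j → j ≤ i + 2 ^ q →
    (∀ v ∈ F, (d i).Win v ↔ c) → (∀ v ∈ F, (d j).Win v ↔ ¬ c) →
    (∀ F' ⊆ F, ∀ l, i ≤ l → l < j → (∀ v ∈ F', (d l).Win v ↔ c) →
      (∀ v ∈ F', (d (l + 1)).Win v ↔ ¬ c) → Solvable k F' N) →
    Solvable k F (N + q) := by
  intro q
  induction q with
  | zero =>
    intro i j F hij hj hi1 hj1 h
    obtain rfl : j = i + 1 := by simp at hj; omega
    exact h F le_rfl i le_rfl hij hi1 hj1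
  | succ q ih =>
    intro i j F hij hj hi1 hj1 h
    by_cases hs : j ≤ i + 2 ^ q
    · exact (ih i j hij hs hi1 hj1 h).mono le_rfl (by omega)
    have hp : 0 < 2 ^ q := by positivity
    rw [pow_succ] at hj
    set t := i + 2 ^ q with ht
    have left : ∀ F' ⊆ F, (∀ v ∈ F', (d t).Win v ↔ ¬ c) → Solvable k F' (N + q) :=
      fun F' hF' h' => ih i t (by omega) le_rfl (fun v hv => hi1 v (hF' hv)) h'
        fun F'' hF'' l h1 h2 => h F'' (hF''.trans hF') l h1 (by omega)
    have right : ∀ F' ⊆ F, (∀ v ∈ F', (d t).Win v ↔ c) → Solvable k F' (N + q) :=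
      fun F' hF' h' => ih t j (by omega) (by omega) h' (fun v hv => hj1 v (hF' hv))
        fun F'' hF'' l h1 h2 => h F'' (hF''.trans hF') l (by omega) h2
    rw [← Nat.add_assoc]
    by_cases hc : c
    · exact duel (d t) (right _ (Set.sep_subset _ _) fun v hv => iff_of_true hv.2 hc)
        (left _ (Set.sep_subset _ _) fun v hv => iff_of_false hv.2 (by simpa using hc))
    · exact duel (d t) (left _ (Set.sep_subset _ _) fun v hv => iff_of_true hv.2 hc)
        (right _ (Set.sep_subset _ _) fun v hv => iff_of_false hv.2 hc)

end Solvable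

/-! ### Interpolation between a duel and its reverse -/

/-- The duel of `α` against `β` in which the first `j` pairs `(α i, β i)` have changed sides. -/
def stage (α β : Fin k → Fin n) (h : Function.Injective (Sum.elim α β)) (j : ℕ) : Duel n k where
  fst := ⟨Finset.univ.image fun i : Fin k => if i.1 < j then β i else α i, by
    rw [Finset.card_image_of_injective]
    · simp
    · intro x y hxy
      have h1 := @h (if x.1 < j then .inr x else .inl x) (if y.1 < j then .inr y else .inl y)
      dsimp only at hxy
      split_ifs at hxy h1 <;> simpa using h1 hxy⟩
  snd := ⟨Finset.univ.image fun i : Fin k => if i.1 < j then α i else β i, by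
    rw [Finset.card_image_of_injective]
    · simp
    · intro x y hxy
      have h1 := @h (if x.1 < j then .inl x else .inr x) (if y.1 < j then .inl y else .inr y)
      dsimp only at hxy
      split_ifs at hxy h1 <;> simpa using h1 hxy⟩
  disj := by
    rw [Finset.disjoint_left]
    simp only [Finset.mem_image, Finset.mem_univ, true_and, not_exists, forall_exists_index]
    rintro z x rfl y hxy
    have h1 := @h (if y.1 < j then .inl y else .inr y) (if x.1 < j then .inr x else .inl x)
    by_cases e : x = y
    · subst e
      split_ifs at hxy h1 <;> simpa using h1 hxy
    · split_ifs at hxy h1 <;> have h2 := h1 hxy <;> simp at h2 <;> exact e h2.symm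

section stage

variable {α β : Fin k → Fin n} (h : Function.Injective (Sum.elim α β)) (v : Fin n → ℝ)

lemma diff_stage (j : ℕ) :
    (stage α β h j).diff v = ∑ i : Fin k, (if i.1 < j then -1 else 1) * (v (α i) - v (β i)) := by
  have h1 := (stage α β h j).fst.2
  have h2 := (stage α β h j).snd.2
  simp only [stage] at h1 h2
  simp only [stage, Duel.diff, value]
  rw [Finset.sum_image (Finset.card_image_iff.1 (by simpa using h1)),
    Finset.sum_image (Finset.card_image_iff.1 (by simpa using h2)), ← Finset.sum_sub_distrib]
  refine Finset.sum_congr rfl fun i _ => ?_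
  split_ifs <;> ring

lemma diff_stage_zero : (stage α β h 0).diff v = ∑ i : Fin k, (v (α i) - v (β i)) := by
  simp [diff_stage]

lemma diff_stage_last : (stage α β h k).diff v = - (stage α β h 0).diff v := by
  simp [diff_stage]

/-- Only pair `j` changes sides, so a change of outcome between the two stages reveals which of `α
j` and `β j` is better. -/
lemma diff_stage_succ (j : Fin k) :
    (stage α β h (j + 1)).diff v = (stage α β h j).diff v - 2 * (v (α j) - v (β j)) := by
  suffices (stage α β h (j + 1)).diff v - (stage α β h j).diff v = - (2 * (v (α j) - v (β j))) by
    linarith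
  rw [diff_stage, diff_stage, ← Finset.sum_sub_distrib, Finset.sum_eq_single j]
  · simp; ring
  · intro i _ hij
    have : i.1 ≠ j.1 := fun e => hij (Fin.ext e)
    have h2 : i.1 < j.1 + 1 ↔ i.1 < j.1 := by omega
    simp [h2]
  · simp

lemma stage_sign_of_le {j : ℕ} {i : Fin k} (hi : j ≤ i.1) :
    (stage α β h j).sign (α i) = 1 ∧ (stage α β h j).sign (β i) = -1 := by
  have hi' : ¬ i.1 < j := by omega
  have ha : α i ∈ (stage α β h j).fst.1 := by
    simp only [stage, Finset.mem_image, Finset.mem_univ, true_and]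
    exact ⟨i, by simp [hi']⟩
  have hb : β i ∈ (stage α β h j).snd.1 := by
    simp only [stage, Finset.mem_image, Finset.mem_univ, true_and]
    exact ⟨i, by simp [hi']⟩
  have hd := (stage α β h j).disj
  have ha' := Finset.disjoint_left.1 hd ha
  have hb' := Finset.disjoint_right.1 hd hb
  simp [Duel.sign, ha, hb, ha', hb']

end stage

/-! ### Known comparisons and tiers -/

/-- For all values in `F`, player `x` is better than player `y`. -/
def Known (F : Set (Fin n → ℝ)) (x y : Fin n) : Prop := ∀ v ∈ F, v y < v x

lemma Known.mono {F F' : Set (Fin n → ℝ)} (hF : F' ⊆ F) {x y : Fin n} (h : Known F x y) :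
    Known F' x y := fun v hv => h v (hF hv)

lemma Known.trans {F : Set (Fin n → ℝ)} {x y z : Fin n} (h : Known F x y) (h' : Known F y z) :
    Known F x z := fun v hv => (h' v hv).trans (h v hv)

/-- The players that cannot be compared by what is known. -/
def unknownGraph (F : Set (Fin n → ℝ)) : SimpleGraph (Fin n) where
  Adj x y := x ≠ y ∧ ¬ Known F x y ∧ ¬ Known F y x
  symm := ⟨fun _ _ h => ⟨h.1.symm, h.2.2, h.2.1⟩⟩
  loopless := ⟨fun _ h => h.1 rfl⟩

lemma unknownGraph_mono {F F' : Set (Fin n → ℝ)} (hF : F' ⊆ F) :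
    unknownGraph F' ≤ unknownGraph F := by
  intro x y h
  exact ⟨h.1, fun h' => h.2.1 (h'.mono hF), fun h' => h.2.2 (h'.mono hF)⟩

/-- The number of connected components of the graph of unknown comparisons. -/
noncomputable def numTiers (F : Set (Fin n → ℝ)) : ℕ :=
  Nat.card (unknownGraph F).ConnectedComponent

/-- The number of ordered pairs of incomparable players. -/
noncomputable def numUnknown (F : Set (Fin n → ℝ)) : ℕ :=
  {e : Fin n × Fin n | (unknownGraph F).Adj e.1 e.2}.ncard

lemma numTiers_le (F : Set (Fin n → ℝ)) : numTiers F ≤ n := by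
  have := Nat.card_le_card_of_surjective (unknownGraph F).connectedComponentMk
    (fun c => c.exists_rep)
  simpa [numTiers] using this

lemma numTiers_mono {F F' : Set (Fin n → ℝ)} (hF : F' ⊆ F) : numTiers F ≤ numTiers F' :=
  Nat.card_le_card_of_surjective
    (SimpleGraph.ConnectedComponent.map (SimpleGraph.Hom.ofLE (unknownGraph_mono hF))) fun c => by
      obtain ⟨x, rfl⟩ := c.exists_rep
      exact ⟨(unknownGraph F').connectedComponentMk x, rfl⟩

/-- Components of the smaller graph map onto those of the larger one; equal cardinalities would make
this map injective, although it identifies the components of `a` and `b`. -/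
lemma numTiers_lt {F F' : Set (Fin n → ℝ)} (hF : F' ⊆ F) {a b : Fin n}
    (h : (unknownGraph F).Reachable a b) (h' : ¬ (unknownGraph F').Reachable a b) :
    numTiers F < numTiers F' := by
  set f := SimpleGraph.ConnectedComponent.map
    (SimpleGraph.Hom.ofLE (unknownGraph_mono hF)) with hf
  have hs : Function.Surjective f := by
    intro c
    obtain ⟨x, rfl⟩ := c.exists_rep
    exact ⟨(unknownGraph F').connectedComponentMk x, rfl⟩
  have hle := Nat.card_le_card_of_surjective f hs
  refine lt_of_le_of_ne hle fun he => h' ?_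
  have hb := (Nat.bijective_iff_surjective_and_card f).2 ⟨hs, he.symm⟩
  exact SimpleGraph.ConnectedComponent.exact
    (@hb.1 ((unknownGraph F').connectedComponentMk a) ((unknownGraph F').connectedComponentMk b)
      (SimpleGraph.ConnectedComponent.sound h))

lemma numUnknown_lt {F F' : Set (Fin n → ℝ)} (hF : F' ⊆ F) {x y : Fin n}
    (h : (unknownGraph F).Adj x y) (h' : ¬ (unknownGraph F').Adj x y) :
    numUnknown F' < numUnknown F := by
  refine Set.ncard_lt_ncard ⟨fun e he => unknownGraph_mono hF he, fun hs => h' ?_⟩ (Set.toFinite _)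
  exact hs (a := (x, y)) h

lemma numUnknown_le (F : Set (Fin n → ℝ)) : numUnknown F ≤ n * n := by
  have := Set.ncard_le_card {e : Fin n × Fin n | (unknownGraph F).Adj e.1 e.2}
  simpa [numUnknown] using this

/-! ### Splitting a tier with the help of a failed exchange -/

/-- A transposition of the ends of a walk is a product of few transpositions of edges. -/
lemma exists_swaps {V : Type*} [DecidableEq V] {G : SimpleGraph V} {x y : V} (w : G.Walk x y) :
    ∃ l : List (V × V), (∀ e ∈ l, G.Adj e.1 e.2) ∧ l.length ≤ 2 * w.length ∧
      (l.map fun e => Equiv.swap e.1 e.2).prod = Equiv.swap x y := by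
  induction w with
  | nil => exact ⟨[], by simp, by simp, (Equiv.swap_self _).symm⟩
  | @cons x z y h w ih =>
    obtain ⟨l, h1, h2, h3⟩ := ih
    rcases eq_or_ne x y with rfl | hxy
    · exact ⟨[], by simp, by simp, (Equiv.swap_self _).symm⟩
    rcases eq_or_ne z y with rfl | hzy
    · refine ⟨[(x, z)], by simpa using h, ?_, by simp⟩
      simp
      omega
    -- Conjugation: `(x y) = (x z)(z y)(x z)`, so each further edge costs two transpositions.
    refine ⟨(x, z) :: (l ++ [(x, z)]), ?_, ?_, ?_⟩
    · intro e he
      simp only [List.mem_cons, List.mem_append, List.not_mem_nil, or_false] at he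
      rcases he with rfl | he | rfl
      · exact h
      · exact h1 e he
      · exact h
    · simp
      omega
    · have := Equiv.swap_mul_swap_mul_swap (x := y) (y := z) (z := x) hzy.symm hxy.symm
      simp only [List.map_cons, List.map_append, List.prod_cons, List.prod_append, h3, List.map_nil,
        List.prod_nil, mul_one]
      rw [← this, Equiv.swap_comm z x, Equiv.swap_comm y z, mul_assoc]

/-- The exchange alters the difference by `(sign x - sign y) * (v y - v x)`. The first factor does
not depend on `v`, so a change of outcome in a fixed direction fixes the sign of `v y - v x`
throughout `F`. -/
lemma known_of_flip {F : Set (Fin n → ℝ)} (d : Duel n k) (c : Prop) {x y : Fin n}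
    (h : ∀ v ∈ F, d.Win v ↔ c) (h' : ∀ v ∈ F, d.Win (v ∘ Equiv.swap x y) ↔ ¬ c) :
    Known F x y ∨ Known F y x := by
  have key := fun v : Fin n → ℝ => d.diff_comp_swap v x y
  simp only [Duel.win_iff] at h h'
  set s := d.sign x - d.sign y
  by_cases hc : c
  · simp only [hc, iff_true, not_true, iff_false, not_lt] at h h'
    rcases le_or_gt s 0 with hs | hs
    · exact .inr fun v hv => by nlinarith [h v hv, h' v hv, key v]
    · exact .inl fun v hv => by nlinarith [h v hv, h' v hv, key v]
  · simp only [hc, iff_false, not_false_iff, iff_true, not_lt] at h h'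
    rcases le_or_gt s 0 with hs | hs
    · exact .inl fun v hv => by nlinarith [h v hv, h' v hv, key v]
    · exact .inr fun v hv => by nlinarith [h v hv, h' v hv, key v]

/-- If the outcome changes between the ends of a sequence of transpositions, then it changes at
one of them. -/
lemma exists_flip_of_swaps (d : Duel n k) (v : Fin n → ℝ) (l : List (Fin n × Fin n))
    (h : ¬ (d.Win v ↔ (d.permute (l.map fun e => Equiv.swap e.1 e.2).prod).Win v)) :
    ∃ e t, (e :: t) <:+ l ∧
      ¬ ((d.permute (t.map fun e => Equiv.swap e.1 e.2).prod).Win v ↔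
        (d.permute ((e :: t).map fun e => Equiv.swap e.1 e.2).prod).Win v) := by
  induction l with
  | nil => exact absurd (by simp [Duel.win_permute]) h
  | cons e l ih =>
    by_cases h1 : d.Win v ↔ (d.permute (l.map fun e => Equiv.swap e.1 e.2).prod).Win v
    · exact ⟨e, l, List.suffix_rfl, by rwa [← h1]⟩
    · obtain ⟨e', t, ht, h'⟩ := ih h1
      exact ⟨e', t, ht.trans (List.suffix_cons _ _), h'⟩

/-- A duel whose outcome changes when two players of the same tier are exchanged allows the
learner to split a tier. -/
lemma Solvable.of_flip [Nonempty (Team n k)] {N : ℕ} {a b : Fin n} (d : Duel n k) :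
    ∀ (u : ℕ) {F : Set (Fin n → ℝ)}, numUnknown F ≤ u →
    (∀ v ∈ F, ¬ (d.Win v ↔ (d.permute (Equiv.swap a b)).Win v)) →
    (unknownGraph F).Reachable a b →
    (∀ F' ⊆ F, numTiers F < numTiers F' → Solvable k F' N) →
    Solvable k F (N + u * (2 * n + 1)) := by
  intro u
  induction u with
  | zero =>
    intro F hu hflip hreach H
    obtain ⟨w⟩ := hreach
    cases w with
    | nil =>
      rcases F.eq_empty_or_nonempty with rfl | ⟨v, hv⟩
      · exact of_empty _
      · exact absurd (by simp [Duel.win_permute]) (hflip v hv)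
    | @cons _ z _ h w =>
      exfalso
      have h0 : numUnknown F = 0 := by omega
      rw [numUnknown, Set.ncard_eq_zero (Set.toFinite _)] at h0
      exact (Set.eq_empty_iff_forall_notMem.1 h0 (a, z)) h
  | succ u ih =>
    intro F hu hflip hreach H
    obtain ⟨w, hw⟩ := hreach.exists_isPath
    have hlen := hw.length_lt
    rw [Fintype.card_fin] at hlen
    obtain ⟨l, hl1, hl2, hl3⟩ := exists_swaps w
    have e : N + (u + 1) * (2 * n + 1) = N + u * (2 * n + 1) + (2 * n + 1) := by ring
    rw [e]
    -- All partial products are tried. A path has fewer than `n` edges, hence `l` has at most `2 *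
    -- n` entries and at most `2 * n + 1` tails.
    refine (batch (l.tails.map fun t => d.permute (t.map fun e => Equiv.swap e.1 e.2).prod)
      (N := N + u * (2 * n + 1)) fun v₀ h₀ => ?_).mono le_rfl (by simp; omega)
    set F' := {v ∈ F | ∀ e ∈ l.tails.map fun t =>
      d.permute (t.map fun e => Equiv.swap e.1 e.2).prod, e.Win v ↔ e.Win v₀} with hF'
    have hsub : F' ⊆ F := Set.sep_subset _ _
    obtain ⟨f, t, hft, hne⟩ := exists_flip_of_swaps d v₀ l (by rw [hl3]; exact hflip v₀ h₀)
    have hknown : Known F' f.1 f.2 ∨ Known F' f.2 f.1 := by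
      refine known_of_flip (d.permute (t.map fun e => Equiv.swap e.1 e.2).prod)
        ((d.permute (t.map fun e => Equiv.swap e.1 e.2).prod).Win v₀) ?_ ?_
      · intro v hv
        exact hv.2 _ (List.mem_map.2 ⟨t, (List.mem_tails _ _).2
          ((List.suffix_cons _ _).trans hft), rfl⟩)
      · intro v hv
        have h1 := hv.2 _ (List.mem_map.2 ⟨f :: t, (List.mem_tails _ _).2 hft, rfl⟩)
        have h2 : (d.permute ((f :: t).map fun e => Equiv.swap e.1 e.2).prod).Win v ↔
            (d.permute (t.map fun e => Equiv.swap e.1 e.2).prod).Win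
              (v ∘ Equiv.swap f.1 f.2) := by
          rw [Duel.win_permute, Duel.win_permute, List.map_cons, List.prod_cons]
          rfl
        rw [← h2, h1]
        tauto
    have hlt : numUnknown F' < numUnknown F :=
      numUnknown_lt hsub (hl1 f (hft.subset (by simp))) fun hadj =>
        hknown.elim hadj.2.1 hadj.2.2
    -- An edge is gone. Either `a` and `b` are still connected and the same flip is used along a new
    -- path, or their tier has split.
    by_cases hr : (unknownGraph F').Reachable a b
    · refine ih (by omega) (fun v hv => hflip v (hsub hv)) hr fun F'' hF'' h' =>
        H F'' (hF''.trans hsub) ((numTiers_mono hsub).trans_lt h')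
    · exact (H F' hsub (numTiers_lt hsub hreach hr)).mono le_rfl (by omega)

/-- The tiers, that is, the components of the graph of unknown comparisons, are linearly
ordered by what is known. -/
lemma exists_rank {F : Set (Fin n → ℝ)} (hF : F.Nonempty) : ∃ ρ : Fin n → ℕ,
    (∀ x y, ρ x = ρ y → (unknownGraph F).Reachable x y) ∧ ∀ x y, ρ x < ρ y → Known F x y := by
  classical
  set G := unknownGraph F
  obtain ⟨v₀, h₀⟩ := hF
  have irr : ∀ x y, Known F x y → ¬ Known F y x := fun x y h h' =>
    lt_asymm (h v₀ h₀) (h' v₀ h₀)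
  have total : ∀ x y, ¬ G.Reachable x y → Known F x y ∨ Known F y x := by
    intro x y h
    by_contra! hc
    exact h (SimpleGraph.Adj.reachable ⟨fun e => h (e ▸ .refl _), hc.1, hc.2⟩)
  -- A comparison with a player of another tier propagates along edges: the opposite one for a
  -- neighbour would, by transitivity, compare the ends of the edge.
  have left : ∀ x x' y, G.Reachable x x' → ¬ G.Reachable x y → Known F x y → Known F x' y := by
    rintro x x' y ⟨w⟩ h hxy
    induction w with
    | nil => exact hxy
    | @cons x z x' hadj w ih =>
      have hzy : ¬ G.Reachable z y := fun h' => h (hadj.reachable.trans h')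
      refine ih hzy ((total z y hzy).resolve_right fun h' => hadj.2.1 (hxy.trans h'))
  -- The rank of a player is the number of players of better tiers.
  let S : Fin n → Finset (Fin n) := fun x => Finset.univ.filter fun z =>
    ¬ G.Reachable z x ∧ Known F z x
  have mem : ∀ x z, z ∈ S x ↔ ¬ G.Reachable z x ∧ Known F z x := by simp [S]
  have lt : ∀ x y, ¬ G.Reachable x y → Known F x y → (S x).card < (S y).card := by
    intro x y h hxy
    refine Finset.card_lt_card (Finset.ssubset_iff_of_subset ?_ |>.2 ⟨x, ?_, ?_⟩)
    · intro z hz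
      rw [mem] at hz ⊢
      refine ⟨fun hzy => ?_, hz.2.trans hxy⟩
      have := left z y x hzy hz.1 hz.2
      exact irr _ _ this hxy
    · exact (mem _ _).2 ⟨h, hxy⟩
    · rw [mem]
      exact fun h' => h'.1 (.refl _)
  have eq : ∀ x y, G.Reachable x y → S y ⊆ S x := by
    intro x y h z hz
    rw [mem] at hz ⊢
    have hzx : ¬ G.Reachable z x := fun h' => hz.1 (h'.trans h)
    refine ⟨hzx, (total z x hzx).resolve_right fun h' => ?_⟩
    exact irr _ _ hz.2 (left x y z h (fun h' => hzx h'.symm) h')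
  refine ⟨fun x => (S x).card, fun x y h => ?_, fun x y h => ?_⟩
  · by_contra hr
    rcases total x y hr with h' | h'
    · exact (lt x y hr h').ne h
    · exact (lt y x (fun h => hr h.symm) h').ne h.symm
  · dsimp only at h
    have hr : ¬ G.Reachable x y := fun h' =>
      absurd (Finset.card_le_card (eq x y h')) (not_le.2 h)
    refine (total x y hr).resolve_right fun h' => ?_
    exact lt_asymm h (lt y x (fun h => hr h.symm) h')

/-! ### Choosing disjoint pairs of close players -/

lemma injective_snoc {j : ℕ} {α β : Fin j → Fin n} (h : Function.Injective (Sum.elim α β))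
    {x y : Fin n} (hxy : x ≠ y) (hx : ∀ i, α i ≠ x ∧ β i ≠ x) (hy : ∀ i, α i ≠ y ∧ β i ≠ y) :
    Function.Injective (Sum.elim (Fin.snoc α x : Fin (j + 1) → Fin n)
      (Fin.snoc β y : Fin (j + 1) → Fin n)) := by
  rw [Sum.elim_injective] at h ⊢
  obtain ⟨h1, h2, h3⟩ := h
  refine ⟨?_, ?_, ?_⟩
  · intro a b
    refine Fin.lastCases ?_ (fun a => ?_) a <;> refine Fin.lastCases ?_ (fun b => ?_) b <;>
      simp only [Fin.snoc_last, Fin.snoc_castSucc]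
    · simp
    · intro h; exact absurd h.symm (hx b).1
    · intro h; exact absurd h (hx a).1
    · intro h; rw [h1 h]
  · intro a b
    refine Fin.lastCases ?_ (fun a => ?_) a <;> refine Fin.lastCases ?_ (fun b => ?_) b <;>
      simp only [Fin.snoc_last, Fin.snoc_castSucc]
    · simp
    · intro h; exact absurd h.symm (hy b).2
    · intro h; exact absurd h (hy a).2
    · intro h; rw [h2 h]
  · intro a b
    refine Fin.lastCases ?_ (fun a => ?_) a <;> refine Fin.lastCases ?_ (fun b => ?_) b <;>
      simp only [Fin.snoc_last, Fin.snoc_castSucc]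
    · exact hxy
    · exact fun h => (hx b).2 h.symm
    · exact (hy a).1
    · exact h3 a b

/-- Disjoint pairs of the same colour, in a set coloured with three colours one of which occurs
an even number of times. -/
lemma exists_pairs (χ : Fin n → Fin 3) : ∀ (j : ℕ) (S : Finset (Fin n)), 2 * j + 1 ≤ S.card →
    (∃ c, Even (S.filter fun z => χ z = c).card) →
    ∃ α β : Fin j → Fin n, Function.Injective (Sum.elim α β) ∧
      ∀ i, α i ∈ S ∧ β i ∈ S ∧ χ (α i) = χ (β i) := by
  intro j
  induction j with
  | zero =>
    intro S _ _
    exact ⟨Fin.elim0, Fin.elim0, fun x => by rcases x with x | x <;> exact x.elim0,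
      fun i => i.elim0⟩
  | succ j ih =>
    intro S hS ⟨c, hc⟩
    obtain ⟨c', hc'⟩ : ∃ c', 1 < (S.filter fun z => χ z = c').card := by
      have hsum := Finset.card_eq_sum_card_fiberwise (f := χ) (s := S) (t := Finset.univ)
        (fun _ _ => by simp)
      rw [Fin.sum_univ_three] at hsum
      by_contra! hle
      have h0 := hle 0
      have h1 := hle 1
      have h2 := hle 2
      -- With no colour repeated, at least three players in three colours mean exactly one of each,
      -- contrary to the even colour. Removing a pair of one colour preserves parity.
      have hcc : (S.filter fun z => χ z = c).card = 1 := by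
        fin_cases c <;> simp only [Fin.zero_eta, Fin.mk_one, Fin.reduceFinMk] <;> omega
      rw [hcc] at hc
      exact absurd hc (by decide)
    obtain ⟨x, hx, y, hy, hxy⟩ := Finset.one_lt_card.1 hc'
    rw [Finset.mem_filter] at hx hy
    have hy' : y ∈ S.erase x := Finset.mem_erase.2 ⟨hxy.symm, hy.1⟩
    obtain ⟨α, β, hinj, hαβ⟩ := ih ((S.erase x).erase y) (by
      rw [Finset.card_erase_of_mem hy', Finset.card_erase_of_mem hx.1]; omega) ⟨c, by
        rw [Finset.filter_erase, Finset.filter_erase]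
        by_cases hcc : c' = c
        · subst hcc
          rw [Finset.card_erase_of_mem, Finset.card_erase_of_mem]
          · rw [Nat.sub_sub]
            exact (Nat.even_sub (by omega)).2 (iff_of_true hc (by decide))
          · simpa using hx
          · simpa using ⟨hxy.symm, hy⟩
        · rw [Finset.erase_eq_of_notMem, Finset.erase_eq_of_notMem]
          · exact hc
          · simp [hx.2, hcc]
          · simp [hy.2, hcc]⟩
    have hS' : ∀ z ∈ (S.erase x).erase y, z ≠ x ∧ z ≠ y ∧ z ∈ S := fun z hz => by
      simp only [Finset.mem_erase] at hz
      exact ⟨hz.2.1, hz.1, hz.2.2⟩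
    refine ⟨Fin.snoc α x, Fin.snoc β y, injective_snoc hinj hxy
      (fun i => ⟨(hS' _ (hαβ i).1).1, (hS' _ (hαβ i).2.1).1⟩)
      (fun i => ⟨(hS' _ (hαβ i).1).2.1, (hS' _ (hαβ i).2.1).2.1⟩), fun i => ?_⟩
    refine Fin.lastCases ?_ (fun i => ?_) i <;> simp only [Fin.snoc_last, Fin.snoc_castSucc]
    · exact ⟨hx.1, hy.1, hx.2.trans hy.2.symm⟩
    · exact ⟨(hS' _ (hαβ i).1).2.2, (hS' _ (hαβ i).2.1).2.2, (hαβ i).2.2⟩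

/-- Disjoint pairs of players which are in the same tier or both between `q₁` and `q₂`. -/
lemma exists_close_pairs (ρ : Fin n → ℕ) {q₁ q₂ : Fin n} (hq : ρ q₁ ≤ ρ q₂) {S : Finset (Fin n)}
    (hS : ∀ z ∈ S, ρ q₁ ≤ ρ z ∧ ρ z ≤ ρ q₂) {j : ℕ} (hj : 2 * j + 1 ≤ S.card)
    (hmem : ρ q₁ < ρ q₂ → q₁ ∈ S ∨ q₂ ∈ S) :
    ∃ α β : Fin j → Fin n, Function.Injective (Sum.elim α β) ∧ ∀ i, α i ∈ S ∧ β i ∈ S ∧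
      (ρ (α i) = ρ (β i) ∨ ∀ z ∈ ({α i, β i} : Set (Fin n)),
        (z = q₁ ∨ ρ q₁ < ρ z) ∧ (z = q₂ ∨ ρ z < ρ q₂)) := by
  classical
  rcases hq.eq_or_lt with he | hlt
  · obtain ⟨α, β, h1, h2⟩ := exists_pairs (fun _ => 0) j S hj ⟨1, by simp⟩
    refine ⟨α, β, h1, fun i => ⟨(h2 i).1, (h2 i).2.1, .inl ?_⟩⟩
    have := hS _ (h2 i).1
    have := hS _ (h2 i).2.1
    omega
  -- The colours are the two extreme tiers and the rest. An end `q₁` or `q₂` may be moved from its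
  -- tier to the rest, where it still lies weakly between the ends; this freedom makes one class
  -- even.
  suffices ∃ P Q : Fin n → Prop, (∀ z, P z → ρ z = ρ q₁) ∧ (∀ z, ρ z = ρ q₁ → z ≠ q₁ → P z) ∧
      (∀ z, Q z → ρ z = ρ q₂) ∧ (∀ z, ρ z = ρ q₂ → z ≠ q₂ → Q z) ∧
      (Even (S.filter P).card ∨ Even (S.filter Q).card) by
    obtain ⟨P, Q, hP1, hP2, hQ1, hQ2, heven⟩ := this
    obtain ⟨α, β, h1, h2⟩ := exists_pairs (fun z => if P z then 0 else if Q z then 1 else 2) j S hj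
      (by
        rcases heven with he | he
        · refine ⟨0, ?_⟩
          convert he using 3 with z
          split_ifs <;> simp_all
        · refine ⟨1, ?_⟩
          convert he using 3 with z
          by_cases hPz : P z
          · have : ¬ Q z := fun h => by have := hP1 z hPz; have := hQ1 z h; omega
            simp [hPz, this]
          · by_cases hQz : Q z <;> simp [hPz, hQz])
    refine ⟨α, β, h1, fun i => ⟨(h2 i).1, (h2 i).2.1, ?_⟩⟩
    obtain ⟨hα, hβ, hc⟩ := h2 i
    have core : ∀ z ∈ S, ¬ P z → ¬ Q z → (z = q₁ ∨ ρ q₁ < ρ z) ∧ (z = q₂ ∨ ρ z < ρ q₂) := by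
      intro z hz hp hq
      have h1 := hS z hz
      refine ⟨or_iff_not_imp_left.2 fun h => ?_, or_iff_not_imp_left.2 fun h => ?_⟩
      · have : ρ z ≠ ρ q₁ := fun e => hp (hP2 z e h)
        omega
      · have : ρ z ≠ ρ q₂ := fun e => hq (hQ2 z e h)
        omega
    by_cases hPα : P (α i)
    · by_cases hPβ : P (β i)
      · exact .inl ((hP1 _ hPα).trans (hP1 _ hPβ).symm)
      · by_cases hQβ : Q (β i) <;> simp [hPα, hPβ, hQβ] at hc
    · by_cases hPβ : P (β i)
      · by_cases hQα : Q (α i) <;> simp [hPα, hPβ, hQα] at hc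
      · by_cases hQα : Q (α i) <;> by_cases hQβ : Q (β i) <;>
          simp [hPα, hPβ, hQα, hQβ] at hc
        · exact .inl ((hQ1 _ hQα).trans (hQ1 _ hQβ).symm)
        · right
          rintro z (rfl | rfl)
          · exact core _ hα hPα hQα
          · exact core _ hβ hPβ hQβ
  have parity : ∀ q ∈ S, ∃ P : Fin n → Prop, (∀ z, P z → ρ z = ρ q) ∧
      (∀ z, ρ z = ρ q → z ≠ q → P z) ∧ Even (S.filter P).card := by
    intro q hqS
    by_cases he : Even (S.filter fun z => ρ z = ρ q).card
    · exact ⟨_, fun z hz => hz, fun z hz _ => hz, by convert he⟩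
    · refine ⟨fun z => ρ z = ρ q ∧ z ≠ q, fun z hz => hz.1, fun z hz hzq => ⟨hz, hzq⟩, ?_⟩
      have : (S.filter fun z => ρ z = ρ q ∧ z ≠ q) = (S.filter fun z => ρ z = ρ q).erase q := by
        ext z
        simp only [Finset.mem_filter, Finset.mem_erase]
        tauto
      have h' := congrArg Finset.card this
      rw [Finset.card_erase_of_mem (by simpa using hqS)] at h'
      suffices Even (S.filter fun z => ρ z = ρ q ∧ z ≠ q).card by convert this
      rw [h']
      exact Nat.Odd.sub_odd (Nat.not_even_iff_odd.1 he) (by decide)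
  rcases hmem hlt with h | h
  · obtain ⟨P, hP1, hP2, hP3⟩ := parity q₁ h
    exact ⟨P, fun z => ρ z = ρ q₂, hP1, hP2, fun _ h => h, fun _ h _ => h, .inl hP3⟩
  · obtain ⟨P, hP1, hP2, hP3⟩ := parity q₂ h
    exact ⟨fun z => ρ z = ρ q₁, P, fun _ h => h, fun _ h _ => h, hP1, hP2, .inr hP3⟩

/-! ### Tests for a large gap -/

/-- A test is a duel together with a pair of players to be exchanged; it is passed if exchanging
the two players does not change the outcome of the duel. -/
def Passes (v : Fin n → ℝ) (t : Duel n k × Fin n × Fin n) : Prop :=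
  t.1.Win v ↔ (t.1.permute (Equiv.swap t.2.1 t.2.2)).Win v

/-- Let `(a, b)` attain the largest difference `δ` within a tier. Passing the tests keeps the
difference of each stage out of `[0, 2δ]`, while the stages must cross this interval. So some pair
differs by more than `δ`; it is not in one tier, hence lies between `q₁` and `q₂`. -/
lemma exists_gap_tests (hk : 1 ≤ k) (ρ : Fin n → ℕ) {q₁ q₂ : Fin n} (hq : ρ q₁ ≤ ρ q₂)
    {S : Finset (Fin n)} (hS : ∀ z ∈ S, ρ q₁ ≤ ρ z ∧ ρ z ≤ ρ q₂) (hcard : 2 * k + 1 ≤ S.card)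
    (h₁ : q₁ ∈ S) (h₂ : q₂ ∈ S) {a b : Fin n} (hab : ρ a = ρ b) :
    ∃ L : Finset (Duel n k × Fin n × Fin n), L.card ≤ k ∧ (∀ t ∈ L, ρ t.2.1 = ρ t.2.2) ∧
      ∀ v, Generic k v → (∀ x y, ρ x < ρ y → v y < v x) →
        (∀ x y, ρ x = ρ y → v x - v y ≤ v a - v b) → (∀ t ∈ L, Passes v t) →
        v a - v b ≤ v q₁ - v q₂ := by
  classical
  rcases eq_or_ne a b with rfl | hne
  · refine ⟨∅, by simp, by simp, fun v _ hv hmax _ => ?_⟩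
    rcases hq.eq_or_lt with he | hlt
    · have := hmax q₂ q₁ he.symm
      linarith
    · have := hv q₁ q₂ hlt
      linarith
  obtain ⟨j, rfl⟩ : ∃ j, k = j + 1 := ⟨k - 1, by omega⟩
  have hS' : ∀ z ∈ (S.erase a).erase b, z ≠ a ∧ z ≠ b ∧ z ∈ S := fun z hz => by
    simp only [Finset.mem_erase] at hz
    exact ⟨hz.2.1, hz.1, hz.2.2⟩
  -- Without `a` and `b`, at least `2 * k - 1 = 2 * j + 1` players are left. Since `a` and `b` share
  -- a tier, they cannot be both ends when the ends have different ranks.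
  obtain ⟨α, β, hinj, hclose⟩ := exists_close_pairs ρ hq (S := (S.erase a).erase b)
    (fun z hz => hS z (hS' z hz).2.2) (j := j)
    (by
      have := Finset.pred_card_le_card_erase (s := S) (a := a)
      have := Finset.pred_card_le_card_erase (s := S.erase a) (a := b)
      omega)
    (fun hlt => by
      by_contra! hc
      simp only [Finset.mem_erase, not_and, h₁, h₂, not_true] at hc
      have e1 : ρ q₁ = ρ a := by
        by_cases e : q₁ = b
        · rw [e, hab]
        · by_cases e' : q₁ = a
          · rw [e']
          · exact absurd e' (by simpa using hc.1 e)
      have e2 : ρ q₂ = ρ a := by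
        by_cases e : q₂ = b
        · rw [e, hab]
        · by_cases e' : q₂ = a
          · rw [e']
          · exact absurd e' (by simpa using hc.2 e)
      omega)
  have hinj' := injective_snoc hinj hne
    (fun i => ⟨(hS' _ (hclose i).1).1, (hS' _ (hclose i).2.1).1⟩)
    (fun i => ⟨(hS' _ (hclose i).1).2.1, (hS' _ (hclose i).2.1).2.1⟩)
  set A : Fin (j + 1) → Fin n := Fin.snoc α a with hA
  set B : Fin (j + 1) → Fin n := Fin.snoc β b with hB
  refine ⟨(Finset.range (j + 1)).image fun i => (stage A B hinj' i, a, b),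
    Finset.card_image_le.trans (by simp), ?_, ?_⟩
  · intro t ht
    obtain ⟨i, _, rfl⟩ := Finset.mem_image.1 ht
    exact hab
  intro v hgen hv hmax hpass
  set δ := v a - v b with hδ
  have hδ0 : 0 ≤ δ := by simpa using hmax a a rfl
  set g : ℕ → ℝ := fun i => (stage A B hinj' i).diff v with hg
  -- The pair `(a, b)` is last, so it has not changed sides; exchanging it subtracts exactly `2 * δ`
  -- from the difference.
  have habs : ∀ i ≤ j, 2 * δ < g i ∨ g i < 0 := by
    intro i hi
    have h1 : Passes v (stage A B hinj' i, a, b) :=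
      hpass _ (Finset.mem_image.2 ⟨i, by simpa using Nat.lt_succ_of_le hi, rfl⟩)
    have h2 := (stage A B hinj' i).diff_comp_swap v a b
    have h3 := stage_sign_of_le hinj' (j := i) (i := Fin.last j) (by simpa using hi)
    have hAl : A (Fin.last j) = a := by simp [hA]
    have hBl : B (Fin.last j) = b := by simp [hB]
    rw [hAl, hBl] at h3
    rw [h3.1, h3.2] at h2
    have h4 := Duel.diff_ne_zero hk (stage A B hinj' i) hgen
    simp only [Passes, Duel.win_iff, Duel.diff_permute] at h1
    rcases lt_or_gt_of_ne h4 with h5 | h5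
    · exact .inr h5
    · have := h1.1 h5
      left
      simp only [hg, hδ]
      linarith
  -- Exchanging `a` and `b` as well would give the reverse of the initial duel. Hence `g 0` and `g
  -- j` lie on opposite sides of `[0, 2δ]`.
  have hend : g j = 2 * δ - g 0 := by
    have h1 := diff_stage_last hinj' v
    have h2 := diff_stage_succ hinj' v (Fin.last j)
    have hAl : A (Fin.last j) = a := by simp [hA]
    have hBl : B (Fin.last j) = b := by simp [hB]
    rw [hAl, hBl] at h2
    simp only [Fin.val_last] at h2
    simp only [hg, hδ]
    linarith
  have hstep : ∀ i : Fin j, g (i + 1) = g i - 2 * (v (α i) - v (β i)) := by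
    intro i
    have h2 := diff_stage_succ hinj' v i.castSucc
    have hAl : A i.castSucc = α i := by simp [hA]
    have hBl : B i.castSucc = β i := by simp [hB]
    rw [hAl, hBl] at h2
    exact h2
  have hgap : ∃ i, δ < |v (α i) - v (β i)| := by
    by_contra! hle
    have keep : ∀ i ≤ j, (2 * δ < g 0 ↔ 2 * δ < g i) := by
      intro i
      induction i with
      | zero => intro _; rfl
      | succ i ih =>
        intro hi
        rw [ih (by omega)]
        have h1 := hstep ⟨i, by omega⟩
        have h2 := abs_le.1 (hle ⟨i, by omega⟩)
        simp only at h1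
        constructor
        · intro h
          rcases habs (i + 1) hi with h3 | h3
          · exact h3
          · linarith
        · intro h
          rcases habs i (by omega) with h3 | h3
          · exact h3
          · linarith
    have h1 := keep j le_rfl
    rcases habs 0 (by omega) with h2 | h2
    · have := h1.1 h2
      linarith
    · have h3 := h1.not.1 (by linarith)
      linarith
  obtain ⟨i, hi⟩ := hgap
  rcases (hclose i).2.2 with he | hcore
  · have h1 := hmax _ _ he
    have h2 := hmax _ _ he.symm
    have := abs_le.2 ⟨by linarith, h1⟩
    linarith
  · have hb : ∀ z ∈ ({α i, β i} : Set (Fin n)), v q₂ ≤ v z ∧ v z ≤ v q₁ := by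
      intro z hz
      obtain ⟨h1, h2⟩ := hcore z hz
      constructor
      · rcases h2 with rfl | h2
        · exact le_rfl
        · exact (hv _ _ h2).le
      · rcases h1 with rfl | h1
        · exact le_rfl
        · exact (hv _ _ h1).le
    have h1 := hb (α i) (by simp)
    have h2 := hb (β i) (by simp)
    have := abs_le.2 (⟨by linarith, by linarith⟩ : -(v q₁ - v q₂) ≤ v (α i) - v (β i) ∧ v (α i) - v (β i) ≤ v q₁ - v q₂)
    linarith

/-! ### Sorted positions and the gain of a rival team -/

/-- An enumeration of the players that is sorted by `ρ`. -/
structure IsSorted (ρ : Fin n → ℕ) (P : ℕ → Fin n) : Prop where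
  inj : ∀ {i j}, i < n → j < n → P i = P j → i = j
  mono : ∀ {i j}, i ≤ j → j < n → ρ (P i) ≤ ρ (P j)
  surj : ∀ x, ∃ i < n, P i = x

lemma exists_isSorted (hn : 0 < n) (ρ : Fin n → ℕ) : ∃ P, IsSorted ρ P := by
  refine ⟨fun i => if h : i < n then Tuple.sort ρ ⟨i, h⟩ else Tuple.sort ρ ⟨0, hn⟩, ?_, ?_, ?_⟩
  · intro i j hi hj h
    simpa [hi, hj] using h
  · intro i j hij hj
    have hi : i < n := by omega
    simp only [hi, hj, dif_pos]
    exact Tuple.monotone_sort ρ (a := ⟨i, hi⟩) (b := ⟨j, hj⟩) hij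
  · intro x
    exact ⟨(Tuple.sort ρ).symm x, Fin.is_lt _, by simp⟩

namespace IsSorted

variable {ρ : Fin n → ℕ} {P : ℕ → Fin n}

lemma injOn (h : IsSorted ρ P) {s : Finset ℕ} (hs : ∀ i ∈ s, i < n) : Set.InjOn P s :=
  fun _ hi _ hj e => h.inj (hs _ hi) (hs _ hj) e

lemma card_image (h : IsSorted ρ P) {s : Finset ℕ} (hs : ∀ i ∈ s, i < n) :
    (s.image P).card = s.card := Finset.card_image_of_injOn (h.injOn hs)

lemma sum_image (h : IsSorted ρ P) {s : Finset ℕ} (hs : ∀ i ∈ s, i < n) (v : Fin n → ℝ) :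
    ∑ x ∈ s.image P, v x = ∑ i ∈ s, v (P i) := Finset.sum_image (h.injOn hs)

/-- The number of positions from `l` to `m - 1` that belong to the tier `τ`. -/
def count (ρ : Fin n → ℕ) (P : ℕ → Fin n) (τ l m : ℕ) : ℕ :=
  ((Finset.Ico l m).filter fun i => ρ (P i) = τ).card

lemma count_le (τ l m : ℕ) : count ρ P τ l m ≤ m - l := by
  simpa [count] using Finset.card_filter_le (Finset.Ico l m) fun i => ρ (P i) = τ

lemma rank_after (h : IsSorted ρ P) {l i : ℕ} (hl : 1 ≤ l)
    (hi : i < count ρ P (ρ (P (l - 1))) l n) : ρ (P (l + i)) = ρ (P (l - 1)) := by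
  have hc := count_le (ρ := ρ) (P := P) (ρ (P (l - 1))) l n
  by_contra hne
  have hgt := lt_of_le_of_ne (h.mono (i := l - 1) (j := l + i) (by omega) (by omega)) (Ne.symm hne)
  refine absurd hi (not_lt.2 ?_)
  calc count ρ P (ρ (P (l - 1))) l n ≤ (Finset.Ico l (l + i)).card := by
        refine Finset.card_le_card fun t ht => ?_
        rw [Finset.mem_filter, Finset.mem_Ico] at ht
        rw [Finset.mem_Ico]
        refine ⟨ht.1.1, ?_⟩
        by_contra! hle
        have := h.mono hle ht.1.2
        omega
    _ = i := by simp

lemma rank_before (h : IsSorted ρ P) {l m i : ℕ} (hm : m ≤ n) (hi : i < m)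
    (hi' : m - i ≤ count ρ P (ρ (P (m - 1))) l m) : ρ (P i) = ρ (P (m - 1)) := by
  by_contra hne
  have hlt := lt_of_le_of_ne (h.mono (i := i) (j := m - 1) (by omega) (by omega)) hne
  refine absurd hi' (not_le.2 ?_)
  calc count ρ P (ρ (P (m - 1))) l m ≤ (Finset.Ico (i + 1) m).card := by
        refine Finset.card_le_card fun t ht => ?_
        rw [Finset.mem_filter, Finset.mem_Ico] at ht
        rw [Finset.mem_Ico]
        refine ⟨?_, ht.1.2⟩
        by_contra! hle
        have := h.mono (i := t) (j := i) (by omega) (by omega)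
        omega
    _ < m - i := by simp; omega

/-- Replacing the players at the positions from `k` to `2 * k - 1` by later players does not gain
much. -/
lemma sum_le (h : IsSorted ρ P) (hk : 1 ≤ k) (hn : 2 * k ≤ n) {v : Fin n → ℝ}
    (hv : ∀ x y, ρ x < ρ y → v y < v x) {δ : ℝ} (hδ : ∀ x y, ρ x = ρ y → v x - v y ≤ δ)
    {B : Finset (Fin n)} (hB : B.card = k) (hdisj : Disjoint ((Finset.range k).image P) B) :
    ∑ x ∈ B, v x - ∑ x ∈ (Finset.Ico k (2 * k)).image P, v x ≤
      (min (count ρ P (ρ (P (2 * k - 1))) (2 * k) n)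
        (count ρ P (ρ (P (2 * k - 1))) k (2 * k)) : ℕ) * δ := by
  classical
  set τ := ρ (P (2 * k - 1)) with hτ
  set B₀ := (Finset.Ico k (2 * k)).image P with hB₀
  have hB₀card : B₀.card = k := by
    rw [hB₀, h.card_image fun i hi => by rw [Finset.mem_Ico] at hi; omega]
    simp
    omega
  obtain ⟨y, hy, hymax⟩ := Finset.exists_max_image (Finset.univ.filter fun z => ρ z = τ) v
    ⟨P (2 * k - 1), by simp [hτ]⟩
  obtain ⟨x, hx, hxmin⟩ := Finset.exists_min_image (Finset.univ.filter fun z => ρ z = τ) v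
    ⟨P (2 * k - 1), by simp [hτ]⟩
  simp only [Finset.mem_filter, Finset.mem_univ, true_and] at hy hymax hx hxmin
  have hδ0 : 0 ≤ δ := by simpa using hδ x x rfl
  have hδ' : 0 ≤ v y - v x := sub_nonneg.2 (hymax x hx)
  rw [← Finset.sum_sdiff_sub_sum_sdiff]
  set I := B \ B₀ with hI
  set J := B₀ \ B with hJ
  have hcard : I.card = J.card := Finset.card_sdiff_comm (hB.trans hB₀card.symm)
  have hIpos : ∀ z ∈ I, ∃ i, 2 * k ≤ i ∧ i < n ∧ P i = z := by
    intro z hz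
    obtain ⟨hzB, hzB₀⟩ := Finset.mem_sdiff.1 hz
    obtain ⟨i, hi, rfl⟩ := h.surj z
    refine ⟨i, ?_, hi, rfl⟩
    by_contra! hlt
    rcases lt_or_ge i k with h1 | h1
    · exact Finset.disjoint_left.1 hdisj (Finset.mem_image.2 ⟨i, by simpa using h1, rfl⟩) hzB
    · exact hzB₀ (Finset.mem_image.2 ⟨i, by simp; omega, rfl⟩)
  have hJpos : ∀ z ∈ J, ∃ i, k ≤ i ∧ i < 2 * k ∧ P i = z := by
    intro z hz
    obtain ⟨i, hi, rfl⟩ := Finset.mem_image.1 (Finset.mem_sdiff.1 hz).1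
    rw [Finset.mem_Ico] at hi
    exact ⟨i, hi.1, hi.2, rfl⟩
  have hIτ : (I.filter fun z => ρ z = τ).card ≤ count ρ P τ (2 * k) n := by
    refine (Finset.card_le_card (t := ((Finset.Ico (2 * k) n).filter fun i => ρ (P i) = τ).image P)
      fun z hz => ?_).trans Finset.card_image_le
    rw [Finset.mem_filter] at hz
    obtain ⟨i, h1, h2, rfl⟩ := hIpos z hz.1
    exact Finset.mem_image.2 ⟨i, by simp [h1, h2, hz.2], rfl⟩
  have hJτ : (J.filter fun z => ρ z = τ).card ≤ count ρ P τ k (2 * k) := by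
    refine (Finset.card_le_card (t := ((Finset.Ico k (2 * k)).filter fun i => ρ (P i) = τ).image P)
      fun z hz => ?_).trans Finset.card_image_le
    rw [Finset.mem_filter] at hz
    obtain ⟨i, h1, h2, rfl⟩ := hJpos z hz.1
    exact Finset.mem_image.2 ⟨i, by simp [h1, h2, hz.2], rfl⟩
  -- Later players outside `τ` are worse than its minimum `v x`; replaced players outside `τ` are
  -- better than its maximum `v y`. The gain is thus at most `(|I ∩ τ| + |J ∩ τ| - |I|) * (v y - v
  -- x)`, and each of the two counts is at most `|I|`.
  have hIsum : ∑ z ∈ I, v z ≤ I.card * v x + (I.filter fun z => ρ z = τ).card * (v y - v x) := by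
    calc ∑ z ∈ I, v z ≤ ∑ z ∈ I, (v x + if ρ z = τ then v y - v x else 0) := by
          refine Finset.sum_le_sum fun z hz => ?_
          split_ifs with hz'
          · linarith [hymax z hz']
          · obtain ⟨i, h1, h2, rfl⟩ := hIpos z hz
            have := h.mono (i := 2 * k - 1) (j := i) (by omega) h2
            have := hv x (P i) (by omega)
            linarith
      _ = _ := by
          rw [Finset.sum_add_distrib, ← Finset.sum_filter, Finset.sum_const, Finset.sum_const]
          simp only [nsmul_eq_mul]
  have hJsum : J.card * v y - (J.filter fun z => ρ z = τ).card * (v y - v x) ≤ ∑ z ∈ J, v z := by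
    calc _ = ∑ z ∈ J, (v y - if ρ z = τ then v y - v x else 0) := by
          rw [Finset.sum_sub_distrib, ← Finset.sum_filter, Finset.sum_const, Finset.sum_const]
          simp only [nsmul_eq_mul]
      _ ≤ ∑ z ∈ J, v z := by
          refine Finset.sum_le_sum fun z hz => ?_
          split_ifs with hz'
          · linarith [hxmin z hz']
          · obtain ⟨i, h1, h2, rfl⟩ := hJpos z hz
            have := h.mono (i := i) (j := 2 * k - 1) (by omega) (by omega)
            have := hv (P i) y (by omega)
            linarith
  have hI' : ((I.filter fun z => ρ z = τ).card : ℝ) ≤ I.card := by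
    exact_mod_cast Finset.card_filter_le _ _
  have hJ' : ((J.filter fun z => ρ z = τ).card : ℝ) ≤ I.card := by
    rw [hcard]
    exact_mod_cast Finset.card_filter_le _ _
  rw [← hcard] at hJsum
  have hyx := hδ y x (hy.trans hx.symm)
  have hIτ' : ((I.filter fun z => ρ z = τ).card : ℝ) ≤ count ρ P τ (2 * k) n := by
    exact_mod_cast hIτ
  have hJτ' : ((J.filter fun z => ρ z = τ).card : ℝ) ≤ count ρ P τ k (2 * k) := by
    exact_mod_cast hJτ
  rcases min_cases (count ρ P τ (2 * k) n) (count ρ P τ k (2 * k)) with ⟨e, _⟩ | ⟨e, _⟩ <;> rw [e]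
  · calc _ ≤ (I.filter fun z => ρ z = τ).card * (v y - v x) := by nlinarith
      _ ≤ _ := by gcongr
  · calc _ ≤ (J.filter fun z => ρ z = τ).card * (v y - v x) := by nlinarith
      _ ≤ _ := by gcongr

end IsSorted

/-! ### Tests certifying a Condorcet winning team -/

/-- If all pairs are sorted or, being in the same tier, pass the test, then `α` beats `β`. -/
lemma exists_stage_tests (hk : 1 ≤ k) (ρ : Fin n → ℕ) (α β : Fin k → Fin n)
    (hinj : Function.Injective (Sum.elim α β)) (hρ : ∀ i, ρ (α i) ≤ ρ (β i)) :
    ∃ L : Finset (Duel n k × Fin n × Fin n), L.card ≤ k ∧ (∀ t ∈ L, ρ t.2.1 = ρ t.2.2) ∧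
      ∀ v, Generic k v → (∀ x y, ρ x < ρ y → v y < v x) → (∀ t ∈ L, Passes v t) →
        0 < ∑ i, (v (α i) - v (β i)) := by
  classical
  refine ⟨(Finset.univ.filter fun i => ρ (α i) = ρ (β i)).image fun i : Fin k =>
    (stage α β hinj i, α i, β i), ?_, ?_, ?_⟩
  · exact (Finset.card_image_le.trans (Finset.card_filter_le _ _)).trans (by simp)
  · intro t ht
    obtain ⟨i, hi, rfl⟩ := Finset.mem_image.1 ht
    simpa using hi
  intro v hgen hv hpass
  rw [← diff_stage_zero hinj]
  by_contra! hle
  -- If `α` did not beat `β`, it would beat it at no stage: moving a better-ranked `α j` to the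
  -- other side only hurts, and for equal ranks the next difference is that of the exchange being
  -- tested. But the last stage reverses the first.
  have hneg : ∀ j ≤ k, (stage α β hinj j).diff v ≤ 0 := by
    intro j
    induction j with
    | zero => exact fun _ => hle
    | succ j ih =>
      intro hj
      have h1 := ih (by omega)
      have h2 := diff_stage_succ hinj v ⟨j, hj⟩
      rcases (hρ ⟨j, hj⟩).eq_or_lt with he | hlt
      · have h3 := hpass (stage α β hinj j, α ⟨j, hj⟩, β ⟨j, hj⟩)
          (Finset.mem_image.2 ⟨⟨j, hj⟩, by simpa using he, rfl⟩)
        simp only [Passes, Duel.win_iff, Duel.diff_permute] at h3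
        have h4 := (stage α β hinj j).diff_comp_swap v (α ⟨j, hj⟩) (β ⟨j, hj⟩)
        obtain ⟨h5, h6⟩ := stage_sign_of_le hinj (j := j) (i := ⟨j, hj⟩) le_rfl
        rw [h5, h6] at h4
        have h7 := h3.not.1 (not_lt.2 h1)
        simp only at h2
        linarith
      · have := hv _ _ hlt
        simp only at h2
        linarith
  have h1 := hneg k le_rfl
  rw [diff_stage_last] at h1
  have h2 := Duel.diff_ne_zero hk (stage α β hinj 0) hgen
  exact h2 (le_antisymm hle (by linarith))

/-- Tests which, when all passed, certify that some team is Condorcet winning. -/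
theorem exists_tests (hk : 1 ≤ k) (hn : 2 * k ≤ n) (ρ : Fin n → ℕ) :
    ∃ (W : Team n k) (L : Finset (Duel n k × Fin n × Fin n)), L.card ≤ 2 * n ^ 4 ∧
      (∀ t ∈ L, ρ t.2.1 = ρ t.2.2) ∧
      ∀ v, Generic k v → (∀ x y, ρ x < ρ y → v y < v x) → (∀ t ∈ L, Passes v t) →
        IsCondorcetWinning (ofValues v) W := by
  classical
  obtain ⟨P, hP⟩ := exists_isSorted (by omega : 0 < n) ρ
  set τ := ρ (P (2 * k - 1)) with hτ
  set c := min (IsSorted.count ρ P τ (2 * k) n) (IsSorted.count ρ P τ k (2 * k)) with hc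
  have hc1 : c ≤ IsSorted.count ρ P τ (2 * k) n := min_le_left _ _
  have hc2 : c ≤ IsSorted.count ρ P τ k (2 * k) := min_le_right _ _
  have hcn : 2 * k + c ≤ n := by
    have := IsSorted.count_le (ρ := ρ) (P := P) τ (2 * k) n
    omega
  have hck : c ≤ k := by
    have := IsSorted.count_le (ρ := ρ) (P := P) τ k (2 * k)
    omega
  -- The pair with the largest difference within a tier is not known to the learner, so tests are
  -- prepared for every pair `(a, b)` and every position `i`.
  have hgap : ∀ t : Fin n × Fin n × Fin n, ∃ L : Finset (Duel n k × Fin n × Fin n), L.card ≤ k ∧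
      (∀ s ∈ L, ρ s.2.1 = ρ s.2.2) ∧ ∀ v, Generic k v → (∀ x y, ρ x < ρ y → v y < v x) →
        2 * k + t.1 < n → ρ t.2.1 = ρ t.2.2 →
        (∀ x y, ρ x = ρ y → v x - v y ≤ v t.2.1 - v t.2.2) → (∀ t ∈ L, Passes v t) →
        v t.2.1 - v t.2.2 ≤ v (P t.1) - v (P (2 * k + t.1)) := by
    rintro ⟨i, a, b⟩
    by_cases h : 2 * k + i.1 < n ∧ ρ a = ρ b
    · have hlt : ∀ t ∈ Finset.Icc i.1 (2 * k + i), t < n := fun t ht => by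
        rw [Finset.mem_Icc] at ht
        omega
      obtain ⟨L, h1, h2, h3⟩ := exists_gap_tests hk ρ (q₁ := P i) (q₂ := P (2 * k + i))
        (hP.mono (by omega) h.1) (S := (Finset.Icc i.1 (2 * k + i)).image P)
        (fun z hz => by
          obtain ⟨t, ht, rfl⟩ := Finset.mem_image.1 hz
          rw [Finset.mem_Icc] at ht
          exact ⟨hP.mono ht.1 (by omega), hP.mono ht.2 h.1⟩)
        (by rw [hP.card_image hlt]; simp; omega)
        (Finset.mem_image_of_mem _ (by simp)) (Finset.mem_image_of_mem _ (by simp)) h.2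
      exact ⟨L, h1, h2, fun v hg hv _ _ => h3 v hg hv⟩
    · exact ⟨∅, by simp, by simp, fun v _ _ h1 h2 => absurd ⟨h1, h2⟩ h⟩
  choose L hL1 hL2 hL3 using hgap
  -- The winning team with its first `c` players replaced by those at positions `2 * k` to `2 * k +
  -- c - 1`. The latter face positions `2 * k - c` to `2 * k - 1`, and by the choice of `c` all of
  -- these are in tier `τ`.
  let α : Fin k → Fin n := fun i => if i.1 < k - c then P (c + i) else P (k + c + i)
  let β : Fin k → Fin n := fun i => P (k + i)
  have hinj : Function.Injective (Sum.elim α β) := by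
    rw [Sum.elim_injective]
    refine ⟨?_, ?_, ?_⟩
    · intro x y hxy
      simp only [α] at hxy
      ext
      split_ifs at hxy <;> have := hP.inj (by omega) (by omega) hxy <;> omega
    · intro x y hxy
      have := hP.inj (by omega) (by omega) hxy
      ext
      omega
    · intro x y hxy
      simp only [α, β] at hxy
      split_ifs at hxy <;> have := hP.inj (by omega) (by omega) hxy <;> omega
  have hαβ : ∀ i, ρ (α i) ≤ ρ (β i) := by
    intro i
    simp only [α, β]
    split_ifs with hi
    · exact hP.mono (by omega) (by omega)
    · have h1 := hP.rank_after (l := 2 * k) (i := c + i - k) (by omega) (by rw [← hτ]; omega)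
      have h2 := hP.rank_before (l := k) (m := 2 * k) (i := k + i) hn (by omega)
        (by rw [← hτ]; omega)
      rw [show 2 * k + (c + i.1 - k) = k + c + i by omega] at h1
      omega
  obtain ⟨L₀, hL₀1, hL₀2, hL₀3⟩ := exists_stage_tests hk ρ α β hinj hαβ
  have hWlt : ∀ i ∈ Finset.range k, i < n := fun i hi => by rw [Finset.mem_range] at hi; omega
  refine ⟨⟨(Finset.range k).image P, by rw [hP.card_image hWlt]; simp⟩,
    L₀ ∪ Finset.univ.biUnion L, ?_, ?_, ?_⟩
  · have h1 : (Finset.univ.biUnion L).card ≤ n ^ 3 * k := by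
      refine (Finset.card_biUnion_le_card_mul _ _ k fun t _ => hL1 t).trans (le_of_eq ?_)
      simp only [Finset.card_univ, Fintype.card_prod, Fintype.card_fin]
      ring
    have h2 := Finset.card_union_le L₀ (Finset.univ.biUnion L)
    have h3 : k ≤ n := by omega
    have h4 : n ^ 3 * k ≤ n ^ 4 := by rw [pow_succ n 3]; exact Nat.mul_le_mul_left _ h3
    have h5 : n ≤ n ^ 4 := Nat.le_self_pow (by norm_num) n
    omega
  · intro t ht
    rcases Finset.mem_union.1 ht with ht | ht
    · exact hL₀2 t ht
    · obtain ⟨s, _, hs⟩ := Finset.mem_biUnion.1 ht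
      exact hL2 s t hs
  intro v hgen hv hpass
  obtain ⟨⟨a, b⟩, hab, hmax⟩ := Finset.exists_max_image
    (Finset.univ.filter fun e : Fin n × Fin n => ρ e.1 = ρ e.2) (fun e => v e.1 - v e.2)
    ⟨(P 0, P 0), by simp⟩
  simp only [Finset.mem_filter, Finset.mem_univ, true_and, Prod.forall] at hab hmax
  have hgaps : ∀ i < c, v a - v b ≤ v (P i) - v (P (2 * k + i)) := by
    intro i hi
    refine hL3 (⟨i, by omega⟩, a, b) v hgen hv (by simp; omega) hab hmax fun t ht => hpass t ?_
    exact Finset.mem_union_right _ (Finset.mem_biUnion.2 ⟨_, Finset.mem_univ _, ht⟩)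
  have hstage := hL₀3 v hgen hv fun t ht => hpass t (Finset.mem_union_left _ ht)
  intro B hB
  have hBsum := hP.sum_le hk hn hv hmax B.2 hB
  have hU : (c : ℝ) * (v a - v b) ≤
      ∑ i ∈ Finset.range c, v (P i) - ∑ i ∈ Finset.range c, v (P (2 * k + i)) := by
    rw [← Finset.sum_sub_distrib, ← nsmul_eq_mul]
    have := Finset.card_nsmul_le_sum (Finset.range c) (fun i => v (P i) - v (P (2 * k + i)))
      (v a - v b) (fun i hi => hgaps i (Finset.mem_range.1 hi))
    simpa using this
  have hαsum : ∑ i, v (α i) = ∑ i ∈ Finset.range (k - c), v (P (c + i)) +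
      ∑ i ∈ Finset.range c, v (P (2 * k + i)) := by
    have h1 := Fin.sum_univ_eq_sum_range
      (fun i => v (if i < k - c then P (c + i) else P (k + c + i))) k
    have h2 : k = (k - c) + c := by omega
    refine h1.trans ?_
    nth_rw 1 [h2]
    rw [Finset.sum_range_add]
    congr 1
    · refine Finset.sum_congr rfl fun i hi => ?_
      rw [if_pos (Finset.mem_range.1 hi)]
    · refine Finset.sum_congr rfl fun i _ => ?_
      rw [if_neg (by omega), show k + c + (k - c + i) = 2 * k + i by omega]
  have hWsum : ∑ i ∈ Finset.range k, v (P i) = ∑ i ∈ Finset.range c, v (P i) +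
      ∑ i ∈ Finset.range (k - c), v (P (c + i)) := by
    have h2 : k = c + (k - c) := by omega
    nth_rw 1 [h2]
    rw [Finset.sum_range_add]
  have hβsum : ∑ i, v (β i) = ∑ x ∈ (Finset.Ico k (2 * k)).image P, v x := by
    rw [hP.sum_image fun i hi => by rw [Finset.mem_Ico] at hi; omega]
    rw [Finset.sum_Ico_eq_sum_range, show 2 * k - k = k by omega]
    exact Fin.sum_univ_eq_sum_range (fun i => v (P (k + i))) k
  rw [Finset.sum_sub_distrib] at hstage
  change ∑ x ∈ B.1, v x < ∑ x ∈ (Finset.range k).image P, v x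
  rw [hP.sum_image hWlt]
  -- The chain is `W ≥ α + c * δ > β + c * δ ≥ B` in total values, with `δ = v a - v b`.
  linarith

/-! ### Repeated testing and splitting of tiers -/

/-- An algorithm for a number of duels polynomial in the number of players. -/
theorem Solvable.of_generic [Nonempty (Team n k)] (hk : 1 ≤ k) (hn : 2 * k ≤ n) :
    ∀ (t : ℕ) {F : Set (Fin n → ℝ)}, (∀ v ∈ F, Generic k v) → n ≤ numTiers F + t →
      Solvable k F ((t + 1) * (7 * n ^ 4)) := by
  classical
  intro t
  induction t using Nat.strong_induction_on with
  | _ t ih =>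
  intro F hF ht
  rcases F.eq_empty_or_nonempty with rfl | hne
  · exact of_empty _
  obtain ⟨ρ, hρ1, hρ2⟩ := exists_rank hne
  obtain ⟨W, L, hL1, hL2, hL3⟩ := exists_tests hk hn ρ
  set M : List (Duel n k) :=
    L.toList.map (fun s => s.1) ++ L.toList.map fun s => s.1.permute (Equiv.swap s.2.1 s.2.2)
    with hM
  have hMlen : M.length ≤ 4 * n ^ 4 := by
    simp [hM]
    omega
  have hn1 : 1 ≤ n := by omega
  have h24 : n * n * (2 * n + 1) ≤ 3 * n ^ 4 := by
    have h1 : n * n * (2 * n + 1) ≤ n * n * (3 * (n * n)) := by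
      gcongr
      nlinarith
    calc _ ≤ _ := h1
      _ = _ := by ring
  -- A round costs `4 * n ^ 4` duels for the tests, two for each, and at most `3 * n ^ 4` for
  -- splitting a tier. The number `t` bounds the splits still possible.
  refine (batch M (N := t * (7 * n ^ 4) + n * n * (2 * n + 1)) fun v₀ h₀ => ?_).mono le_rfl (by
    have : (t + 1) * (7 * n ^ 4) = t * (7 * n ^ 4) + 7 * n ^ 4 := by ring
    omega)
  set F' := {v ∈ F | ∀ d ∈ M, d.Win v ↔ d.Win v₀} with hF'
  by_cases hpass : ∀ s ∈ L, Passes v₀ s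
  · refine (of_winning (F := F') W fun v hv => ?_).mono le_rfl (Nat.zero_le _)
    refine hL3 v (hF v hv.1) (fun x y hxy => hρ2 x y hxy v hv.1) fun s hs => ?_
    have h1 := hv.2 s.1 (List.mem_append_left _ (List.mem_map.2 ⟨s, by simpa using hs, rfl⟩))
    have h2 := hv.2 _ (List.mem_append_right _ (List.mem_map.2 ⟨s, by simpa using hs, rfl⟩))
    exact h1.trans ((hpass s hs).trans h2.symm)
  · push Not at hpass
    obtain ⟨s, hs, hfail⟩ := hpass
    have hflip : ∀ v ∈ F', ¬ (s.1.Win v ↔ (s.1.permute (Equiv.swap s.2.1 s.2.2)).Win v) := by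
      intro v hv
      have h1 := hv.2 s.1 (List.mem_append_left _ (List.mem_map.2 ⟨s, by simpa using hs, rfl⟩))
      have h2 := hv.2 _ (List.mem_append_right _ (List.mem_map.2 ⟨s, by simpa using hs, rfl⟩))
      rw [h1, h2]
      exact hfail
    have hsub : F' ⊆ F := Set.sep_subset _ _
    have hsplit : ∀ F'' ⊆ F, numTiers F < numTiers F'' → Solvable k F'' (t * (7 * n ^ 4)) := by
      intro F'' hF'' hlt
      have h1 := numTiers_le F''
      obtain ⟨t, rfl⟩ : ∃ t', t = t' + 1 := ⟨t - 1, by omega⟩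
      exact ih t (by omega) (fun v hv => hF v (hF'' hv)) (by omega)
    have hle : numTiers F ≤ numTiers F' := numTiers_mono hsub
    by_cases hr : (unknownGraph F').Reachable s.2.1 s.2.2
    · exact of_flip s.1 (n * n) (numUnknown_le F') hflip hr fun F'' hF'' hlt =>
        hsplit F'' (hF''.trans hsub) (by omega)
    · exact (hsplit F' hsub (numTiers_lt hsub (hρ1 _ _ (hL2 s hs)) hr)).mono le_rfl (by omega)

/-! ### Playing with a subset of the players -/

/-- The image of a team under an embedding of the players. -/
def Team.map (f : Fin m ↪ Fin n) (A : Team m k) : Team n k := ⟨A.1.map f, by simp [A.2]⟩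

lemma value_map (f : Fin m ↪ Fin n) (v : Fin n → ℝ) (A : Team m k) :
    value v (Team.map f A) = value (v ∘ f) A := by
  simp [value, Team.map]

lemma Generic.comp {v : Fin n → ℝ} (hv : Generic k v) (f : Fin m ↪ Fin n) :
    Generic k (v ∘ f) := by
  intro A B hAB
  rw [← value_map, ← value_map]
  refine hv _ _ fun h => hAB ?_
  exact Subtype.ext (Finset.map_injective f (congrArg Subtype.val h))

/-- The algorithm that works with some of the players only. -/
def Algo.map (f : Fin m ↪ Fin n) : Algo m k → Algo n k
  | .output W => .output (Team.map f W)
  | .duel A B h a b => .duel (Team.map f A) (Team.map f B) ((Finset.disjoint_map f).2 h)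
      (a.map f) (b.map f)

lemma Algo.run_map (f : Fin m ↪ Fin n) (v : Fin n → ℝ) (alg : Algo m k) :
    (alg.map f).result (ofValues v) = Team.map f (alg.result (ofValues (v ∘ f))) ∧
      (alg.map f).numDuels (ofValues v) = alg.numDuels (ofValues (v ∘ f)) := by
  induction alg with
  | output W => exact ⟨rfl, rfl⟩
  | duel A B h a b iha ihb =>
    have he : ofValues v (Team.map f A) (Team.map f B) ↔ ofValues (v ∘ f) A B := by
      simp [ofValues, value_map]
    by_cases hw : ofValues (v ∘ f) A B
    · simpa [Algo.map, Algo.result, Algo.numDuels, he, hw] using iha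
    · simpa [Algo.map, Algo.result, Algo.numDuels, he, hw] using ihb

lemma Solvable.map {F₀ : Set (Fin m → ℝ)} {F : Set (Fin n → ℝ)} {N : ℕ} (h : Solvable k F₀ N)
    (f : Fin m ↪ Fin n) (hF : ∀ v ∈ F, v ∘ f ∈ F₀)
    (hW : ∀ v ∈ F, ∀ W : Team m k, IsCondorcetWinning (ofValues (v ∘ f)) W →
      IsCondorcetWinning (ofValues v) (Team.map f W)) : Solvable k F N := by
  obtain ⟨alg, h⟩ := h
  refine ⟨alg.map f, fun v hv => ?_⟩
  obtain ⟨h1, h2⟩ := alg.run_map f v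
  rw [h1, h2]
  exact ⟨hW v hv _ (h _ (hF v hv)).1, (h _ (hF v hv)).2⟩

/-! ### Eliminating players -/

open Classical in
/-- The players known to be better than `y`. -/
noncomputable def betterThan (F : Set (Fin n → ℝ)) (y : Fin n) : Finset (Fin n) :=
  Finset.univ.filter fun x => Known F x y

lemma mem_betterThan {F : Set (Fin n → ℝ)} {x y : Fin n} : x ∈ betterThan F y ↔ Known F x y := by
  simp [betterThan]

/-- The players that may be among the best `2 * k` ones. -/
noncomputable def alive (k : ℕ) (F : Set (Fin n → ℝ)) : Finset (Fin n) :=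
  Finset.univ.filter fun y => (betterThan F y).card < 2 * k

lemma mem_alive {F : Set (Fin n → ℝ)} {y : Fin n} :
    y ∈ alive k F ↔ (betterThan F y).card < 2 * k := by
  simp [alive]

/-- The players known to be better than the best eliminated one are all alive. -/
lemma le_card_alive {F : Set (Fin n → ℝ)} (hF : F.Nonempty) (hn : 2 * k ≤ n) :
    2 * k ≤ (alive k F).card := by
  obtain ⟨v, hv⟩ := hF
  by_cases h : (alive k F)ᶜ.Nonempty
  · obtain ⟨y, hy, hmax⟩ := Finset.exists_max_image _ v h
    rw [Finset.mem_compl, mem_alive, not_lt] at hy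
    refine hy.trans (Finset.card_le_card fun x hx => ?_)
    by_contra hx'
    have h1 := hmax x (Finset.mem_compl.2 hx')
    have h2 := mem_betterThan.1 hx v hv
    linarith
  · rw [Finset.not_nonempty_iff_eq_empty, Finset.compl_eq_empty_iff] at h
    simpa [h] using hn

/-- A team of live players that wins against all teams of live players is Condorcet winning. -/
lemma isCondorcetWinning_of_alive {F : Set (Fin n → ℝ)} {v : Fin n → ℝ} (hv : v ∈ F) {W : Team n k}
    (hW : ∀ B : Team n k, B.1 ⊆ alive k F → Disjoint W.1 B.1 → value v B < value v W) :
    IsCondorcetWinning (ofValues v) W := by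
  classical
  intro B₀ hB₀
  obtain ⟨B, hB, hmax⟩ := Finset.exists_max_image
    (Finset.univ.filter fun B : Team n k => Disjoint W.1 B.1) (value v) ⟨B₀, by simpa using hB₀⟩
  simp only [Finset.mem_filter, Finset.mem_univ, true_and] at hB hmax
  refine (hmax B₀ hB₀).trans_lt (hW B ?_ hB)
  intro y hy
  by_contra hy'
  rw [mem_alive, not_lt] at hy'
  have hcard : ((W.1 ∪ B.1).erase y).card < (betterThan F y).card := by
    have h1 : (W.1 ∪ B.1).card = 2 * k := by
      rw [Finset.card_union_of_disjoint hB, W.2, B.2]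
      ring
    have h2 := Finset.card_erase_lt_of_mem (Finset.mem_union_right W.1 hy)
    omega
  -- An eliminated `y` in a best rival team could be replaced by a better player outside both teams.
  obtain ⟨x, hx, hx'⟩ := Finset.exists_mem_notMem_of_card_lt_card hcard
  have hxy := mem_betterThan.1 hx v hv
  have hne : x ≠ y := fun e => by subst e; exact lt_irrefl _ hxy
  simp only [Finset.mem_erase, Finset.mem_union, not_and, not_or] at hx'
  obtain ⟨hxW, hxB⟩ := hx' hne
  have hxB' : x ∉ B.1.erase y := fun h => hxB (Finset.mem_of_mem_erase h)
  have h3 := hmax ⟨insert x (B.1.erase y), by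
    rw [Finset.card_insert_of_notMem hxB', Finset.card_erase_of_mem hy, B.2]
    have : 0 < B.1.card := Finset.card_pos.2 ⟨y, hy⟩
    rw [B.2] at this
    omega⟩ (by
      simp only [Finset.disjoint_insert_right]
      exact ⟨hxW, Finset.disjoint_of_subset_right (Finset.erase_subset _ _) hB⟩)
  simp only [value, Finset.sum_insert hxB'] at h3
  have h4 := Finset.add_sum_erase B.1 v hy
  linarith

/-- If many players are alive, then there are `k` disjoint pairs of incomparable live players. -/
lemma exists_unknown_pairs {F : Set (Fin n → ℝ)} (hF : F.Nonempty)
    (h : 4 * k ≤ (alive k F).card) : ∀ j ≤ k, ∃ α β : Fin j → Fin n,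
    Function.Injective (Sum.elim α β) ∧ ∀ i, α i ∈ alive k F ∧ β i ∈ alive k F ∧
      ¬ Known F (α i) (β i) ∧ ¬ Known F (β i) (α i) := by
  classical
  obtain ⟨v, hv⟩ := hF
  intro j
  induction j with
  | zero =>
    intro _
    exact ⟨Fin.elim0, Fin.elim0, fun x => by rcases x with x | x <;> exact x.elim0,
      fun i => i.elim0⟩
  | succ j ih =>
    intro hj
    obtain ⟨α, β, hinj, hαβ⟩ := ih (by omega)
    set S := alive k F \ (Finset.univ.image α ∪ Finset.univ.image β) with hS
    have hScard : 2 * k + 2 ≤ S.card := by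
      have h1 := Finset.le_card_sdiff (Finset.univ.image α ∪ Finset.univ.image β) (alive k F)
      rw [← hS] at h1
      have h2 := Finset.card_union_le (Finset.univ.image α) (Finset.univ.image β)
      have h3 := Finset.card_image_le (s := Finset.univ) (f := α)
      have h4 := Finset.card_image_le (s := Finset.univ) (f := β)
      simp only [Finset.card_univ, Fintype.card_fin] at h3 h4
      omega
    -- The worst unused live player for some `v ∈ F` cannot be known to beat another, and fewer than
    -- `2 * k` are known to beat it.
    obtain ⟨y, hy, hmin⟩ := Finset.exists_min_image S v (Finset.card_pos.1 (by omega))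
    have hyS := Finset.mem_sdiff.1 hy
    have hcard : (betterThan F y).card < (S.erase y).card := by
      rw [Finset.card_erase_of_mem hy]
      have := mem_alive.1 hyS.1
      omega
    obtain ⟨x, hx, hx'⟩ := Finset.exists_mem_notMem_of_card_lt_card hcard
    rw [mem_betterThan] at hx'
    obtain ⟨hxy, hxS'⟩ := Finset.mem_erase.1 hx
    have hxS := Finset.mem_sdiff.1 hxS'
    have hyx : ¬ Known F y x := fun hk => not_lt.2 (hmin x hxS') (hk v hv)
    simp only [Finset.mem_union, Finset.mem_image, Finset.mem_univ, true_and, not_or,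
      not_exists] at hxS hyS
    refine ⟨Fin.snoc α x, Fin.snoc β y, injective_snoc hinj hxy
      (fun i => ⟨hxS.2.1 i, hxS.2.2 i⟩) (fun i => ⟨hyS.2.1 i, hyS.2.2 i⟩), fun i => ?_⟩
    refine Fin.lastCases ?_ (fun i => ?_) i <;> simp only [Fin.snoc_last, Fin.snoc_castSucc]
    · exact ⟨hxS.1, hyS.1, hx', hyx⟩
    · exact hαβ i

/-- The progress of the learner in eliminating players. -/
noncomputable def progress (k : ℕ) (F : Set (Fin n → ℝ)) : ℕ :=
  ∑ y, min (betterThan F y).card (2 * k)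

lemma progress_le (F : Set (Fin n → ℝ)) : progress k F ≤ 2 * k * n := by
  calc progress k F ≤ ∑ _y : Fin n, 2 * k := Finset.sum_le_sum fun _ _ => min_le_right _ _
    _ = 2 * k * n := by simp; ring

lemma progress_lt {F F' : Set (Fin n → ℝ)} (hF : F' ⊆ F) {x y : Fin n} (hy : y ∈ alive k F)
    (h : ¬ Known F x y) (h' : Known F' x y) : progress k F < progress k F' := by
  have hsub : ∀ z, betterThan F z ⊆ betterThan F' z := fun z w hw =>
    mem_betterThan.2 ((mem_betterThan.1 hw).mono hF)
  refine Finset.sum_lt_sum (fun z _ => ?_) ⟨y, Finset.mem_univ _, ?_⟩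
  · have := Finset.card_le_card (hsub z)
    omega
  · have h1 : (betterThan F y).card < (betterThan F' y).card :=
      Finset.card_lt_card ((Finset.ssubset_iff_of_subset (hsub y)).2
        ⟨x, mem_betterThan.2 h', fun hx => h (mem_betterThan.1 hx)⟩)
    have := mem_alive.1 hy
    omega

namespace Solvable

/-- One duel fixes the outcome of the first stage, and the binary search finds a pair that becomes
comparable. Its worse player was alive, so the truncated count in `progress` grows. -/
lemma of_many_alive (hk : 1 ≤ k) {F : Set (Fin n → ℝ)} (hF : F.Nonempty)
    (hgen : ∀ v ∈ F, Generic k v) (h : 4 * k ≤ (alive k F).card) {N : ℕ}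
    (H : ∀ F' ⊆ F, progress k F < progress k F' → Solvable k F' N) :
    Solvable k F (N + (Nat.clog 2 k + 1)) := by
  obtain ⟨α, β, hinj, hαβ⟩ := exists_unknown_pairs hF h k le_rfl
  have main : ∀ c : Prop, ∀ F' ⊆ F, (∀ v ∈ F', (stage α β hinj 0).Win v ↔ c) →
      Solvable k F' (N + Nat.clog 2 k) := by
    intro c F' hF' h0
    refine binary_search (stage α β hinj) c (Nat.clog 2 k) 0 k hk
      (by simpa using Nat.le_pow_clog (by norm_num) k) h0 ?_ ?_
    · intro v hv
      rw [← h0 v hv, Duel.win_iff, Duel.win_iff, diff_stage_last]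
      have := Duel.diff_ne_zero hk (stage α β hinj 0) (hgen v (hF' hv))
      rcases lt_or_gt_of_ne this with h1 | h1
      · exact iff_of_true (by linarith) (by linarith)
      · exact iff_of_false (by linarith) (by simpa using h1)
    · intro F'' hF'' l _ hl h1 h2
      have hstep : ∀ v, _ := fun v => diff_stage_succ hinj v ⟨l, hl⟩
      simp only at hstep
      simp only [Duel.win_iff, hstep] at h1 h2
      obtain ⟨ha, hb, hab, hba⟩ := hαβ ⟨l, hl⟩
      by_cases hc : c
      · simp only [hc, iff_true, not_true, iff_false, not_lt] at h1 h2
        refine H F'' (hF''.trans hF') (progress_lt (hF''.trans hF') hb hab fun v hv => ?_)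
        linarith [h1 v hv, h2 v hv]
      · simp only [hc, iff_false, not_false_iff, iff_true, not_lt] at h1 h2
        refine H F'' (hF''.trans hF') (progress_lt (hF''.trans hF') ha hba fun v hv => ?_)
        linarith [h1 v hv, h2 v hv]
  rw [← Nat.add_assoc]
  exact duel (stage α β hinj 0)
    (main True _ (Set.sep_subset _ _) fun v hv => iff_of_true hv.2 trivial)
    (main False _ (Set.sep_subset _ _) fun v hv => iff_of_false hv.2 id)

/-- The polynomial algorithm is started afresh on the live players; comparisons among them may be
forgotten, since only genericity is needed. -/
lemma of_few_alive (hk : 1 ≤ k) (hn : 2 * k ≤ n) {F : Set (Fin n → ℝ)} (hF : F.Nonempty)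
    (hgen : ∀ v ∈ F, Generic k v) (h : (alive k F).card ≤ 4 * k) :
    Solvable k F (8960 * k ^ 5) := by
  set m := (alive k F).card with hm
  have hm2 : 2 * k ≤ m := le_card_alive hF hn
  set f : Fin m ↪ Fin n := ((alive k F).orderEmbOfFin rfl).toEmbedding with hf
  have hrange : ∀ x, x ∈ alive k F ↔ ∃ i, f i = x := by
    intro x
    have := Finset.range_orderEmbOfFin (alive k F) rfl
    have h1 : x ∈ Set.range ((alive k F).orderEmbOfFin rfl) ↔ x ∈ alive k F := by
      rw [this]
      rfl
    rw [← h1]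
    rfl
  have : Nonempty (Team m k) := by
    obtain ⟨A, hA⟩ := Finset.exists_subset_card_eq (s := (Finset.univ : Finset (Fin m))) (n := k)
      (by simp; omega)
    exact ⟨⟨A, hA.2⟩⟩
  have hsolve := of_generic (n := m) hk hm2 m (F := {v | Generic k v}) (fun v hv => hv) (by omega)
  refine (hsolve.map f (F := F) (fun v hv => (hgen v hv).comp f) ?_).mono le_rfl ?_
  · intro v hv W hW
    refine isCondorcetWinning_of_alive hv fun B hB hdisj => ?_
    obtain ⟨B', hB'⟩ : ∃ B' : Team m k, Team.map f B' = B := by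
      obtain ⟨s, hs⟩ : ∃ s : Finset (Fin m), s.map f = B.1 := by
        refine ⟨B.1.preimage f f.injective.injOn, ?_⟩
        ext x
        simp only [Finset.mem_map, Finset.mem_preimage]
        constructor
        · rintro ⟨i, hi, rfl⟩
          exact hi
        · intro hx
          obtain ⟨i, rfl⟩ := (hrange x).1 (hB hx)
          exact ⟨i, hx, rfl⟩
      exact ⟨⟨s, by rw [← Finset.card_map f, hs, B.2]⟩, Subtype.ext hs⟩
    subst hB'
    rw [value_map, value_map]
    exact hW B' ((Finset.disjoint_map f).1 hdisj)
  · calc (m + 1) * (7 * m ^ 4) ≤ (5 * k) * (7 * (4 * k) ^ 4) := by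
          gcongr
          omega
      _ = 8960 * k ^ 5 := by ring

lemma of_progress [Nonempty (Team n k)] (hk : 1 ≤ k) (hn : 2 * k ≤ n) :
    ∀ (t : ℕ) {F : Set (Fin n → ℝ)}, (∀ v ∈ F, Generic k v) → 2 * k * n ≤ progress k F + t →
      Solvable k F (8960 * k ^ 5 + (t + 1) * (Nat.clog 2 k + 1)) := by
  intro t
  induction t with
  | zero =>
    intro F hgen ht
    rcases F.eq_empty_or_nonempty with rfl | hF
    · exact of_empty _
    rcases le_total (alive k F).card (4 * k) with h | h
    · exact (of_few_alive hk hn hF hgen h).mono le_rfl (by omega)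
    · refine (of_many_alive hk hF hgen h (N := 0) fun F' hF' hlt => ?_).mono le_rfl (by omega)
      have := progress_le (k := k) F'
      omega
  | succ t ih =>
    intro F hgen ht
    rcases F.eq_empty_or_nonempty with rfl | hF
    · exact of_empty _
    rcases le_total (alive k F).card (4 * k) with h | h
    · exact (of_few_alive hk hn hF hgen h).mono le_rfl (by omega)
    · refine (of_many_alive hk hF hgen h fun F' hF' hlt =>
        ih (fun v hv => hgen v (hF' hv)) (by omega)).mono le_rfl (le_of_eq (by ring))

end Solvable

/-! ### The logarithmic bound and the theorem -/

lemma clog_add_one_le (hk : 1 ≤ k) :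
    (Nat.clog 2 k : ℝ) + 1 ≤ 6 * Real.log (max (k : ℝ) 2) := by
  have h2 : 1 / 2 < Real.log 2 := by linarith [Real.log_two_gt_d9]
  have hX : Real.log 2 ≤ Real.log (max (k : ℝ) 2) :=
    Real.log_le_log (by norm_num) (le_max_right _ _)
  rcases hk.eq_or_lt with rfl | hk'
  · simp only [Nat.clog_one_right, Nat.cast_zero]
    linarith
  have hXk : Real.log k ≤ Real.log (max (k : ℝ) 2) :=
    Real.log_le_log (by positivity) (le_max_left _ _)
  have h1 : (2 : ℝ) ^ (Nat.clog 2 k).pred ≤ k := by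
    exact_mod_cast (Nat.pow_pred_clog_lt_self (b := 2) (by norm_num) hk').le
  have h3 := Real.log_le_log (by positivity) h1
  rw [Real.log_pow] at h3
  have hpos : 0 < Nat.clog 2 k := Nat.clog_pos (by norm_num) hk'
  have h4 : ((Nat.clog 2 k).pred : ℝ) = Nat.clog 2 k - 1 := by
    rw [Nat.pred_eq_sub_one, Nat.cast_sub hpos]
    simp
  rw [h4] at h3
  have h5 : (0 : ℝ) ≤ Nat.clog 2 k - 1 := by
    have : (1 : ℝ) ≤ Nat.clog 2 k := by exact_mod_cast hpos
    linarith
  nlinarith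

end DuelingTeams

theorem theorem6 :
    ∃ C : ℝ, ∀ n k : ℕ, 1 ≤ k → 2 * k ≤ n →
      ∃ alg : DuelingTeams.Algo n k,
        ∀ r : DuelingTeams.Team n k → DuelingTeams.Team n k → Prop,
          IsStrictTotalOrder (DuelingTeams.Team n k) r → DuelingTeams.IsAdditive r →
            DuelingTeams.IsCondorcetWinning r (alg.result r) ∧
            (alg.numDuels r : ℝ) ≤
              C * ((k : ℝ) * (n : ℝ) * Real.log (max (k : ℝ) 2) + (k : ℝ) ^ 5) := by
  refine ⟨8960, fun n k hk hn => ?_⟩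
  have : Nonempty (DuelingTeams.Team n k) := by
    obtain ⟨A, hA⟩ := Finset.exists_subset_card_eq (s := (Finset.univ : Finset (Fin n))) (n := k)
      (by simp; omega)
    exact ⟨⟨A, hA.2⟩⟩
  obtain ⟨alg, halg⟩ := DuelingTeams.Solvable.of_progress hk hn (2 * k * n)
    (F := {v | DuelingTeams.Generic k v}) (fun v hv => hv) (by omega)
  refine ⟨alg, fun r hr ⟨v, hv⟩ => ?_⟩
  obtain rfl : r = DuelingTeams.ofValues v := by
    funext A B
    exact propext (hv A B)
  -- Trichotomy of the order excludes ties between distinct teams.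
  have hgen : DuelingTeams.Generic k v := by
    intro A B hAB he
    rcases hr.toTrichotomous.rel_or_eq_or_rel_swap (a := A) (b := B) with h | h | h
    · exact absurd he (ne_of_gt h)
    · exact hAB h
    · exact absurd he (ne_of_lt h)
  obtain ⟨h1, h2⟩ := halg v hgen
  refine ⟨h1, ?_⟩
  have h3 : (alg.numDuels (DuelingTeams.ofValues v) : ℝ) ≤
      8960 * (k : ℝ) ^ 5 + (2 * k * n + 1) * ((Nat.clog 2 k : ℝ) + 1) := by
    exact_mod_cast h2
  have h4 := DuelingTeams.clog_add_one_le hk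
  have hkn : (1 : ℝ) ≤ k * n := by
    exact_mod_cast Nat.one_le_iff_ne_zero.2 (Nat.mul_ne_zero (by omega) (by omega))
  have hlog : 0 ≤ Real.log (max (k : ℝ) 2) :=
    Real.log_nonneg (le_trans (by norm_num) (le_max_right _ _))
  calc (alg.numDuels (DuelingTeams.ofValues v) : ℝ)
      ≤ 8960 * (k : ℝ) ^ 5 + (2 * k * n + 1) * ((Nat.clog 2 k : ℝ) + 1) := h3
    _ ≤ 8960 * (k : ℝ) ^ 5 + (3 * (k * n)) * (6 * Real.log (max (k : ℝ) 2)) := by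
        gcongr
        linarith
    _ ≤ 8960 * ((k : ℝ) * n * Real.log (max (k : ℝ) 2) + (k : ℝ) ^ 5) := by
        have := mul_nonneg (zero_le_one.trans hkn) hlog
        nlinarith
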